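/- Let $p\in\,]1,2]$, $\sigma\ge 0$, $\varepsilon>0$, $\lambda>0$, $L>0$ and $R\in\mathbb{R}$. Then there is a constant $c\ge 0$, depending only on $p,\sigma,\varepsilon,\lambda,L,R$, such that the following holds. Let $\mathsf H$ be a real separable Hilbert space, $f\colon\mathsf H\to\mathbb R$ convex and $L$-Lipschitz, $\mathsf X\subset\mathsf H$ closed and convex, and let $x_*\in\mathsf X$ satisfy $f(x_*)=f_*:=\min_{\mathsf X}f$. Let $\xi$ be a random variable on a probability space $(\Omega,\mathbb P)$ and let $\hat u(x,s)\in\mathsf H$ be jointly measurable in $x\in\mathsf X$ and $s$, such that for every $x\in\mathsf X$: $\mathbb E\|\hat u(x,\xi)\|<+\infty$, $\mathbb E[\hat u(x,\xi)]\in\partial f(x)=\{u\in\mathsf H: f(y)\ge f(x)+\langle u,y-x\rangle\ \forall y\in\mathsf H\}$, and $\mathbb E\big[\|\hat u(x,\xi)-\mathbb E[\hat u(x,\xi)]\|^p\big]\le\sigma^p$. Let $m\ge 1$ be a batch size, let $(\xi^k_j)_{k\ge 1,\,1\le j\le m}$ be independent copies of $\xi$ on $\Omega$, and let $x_1\in\mathsf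 X$ be deterministic with $\|x_1-x_*\|\le R$. Given stepsizes $\gamma_k$ and clipping levels $\lambda_k$, the clipped stochastic subgradient method is $$\bar u_k=\frac1m\sum_{j=1}^m\hat u(x_k,\xi^k_j),\qquad \tilde u_k=\max\{\|\bar u_k\|/\lambda_k,1\}^{-1}\,\bar u_k,\qquad x_{k+1}=P_{\mathsf X}(x_k-\gamma_k\tilde u_k),$$ where $P_{\mathsf X}$ is the orthogonal projection onto $\mathsf X$; set $\bar x_k=\frac1k\sum_{i=1}^k x_i$. Let $\delta\in\,]0,2/e]$ and $\gamma=1/\log(2/\delta)$. Then for every integer $k\ge1$ the following hold. (i) (Anytime.) If $\gamma_i=\dfrac{\gamma}{(i(1+\log i))^{1/p}}$ and $\lambda_i=\max\{(1+\varepsilon)L,\lambda(i(1+\log i))^{1/p}\}$ for all $i\ge 1$, then with probability at least $1-\delta$ $$f(\bar x_k)-f_*\le c\,\frac{(1+\log k)^{1/p}}{k^{(p-1)/p}}\Big((1+\log(1+\log k))^2+\log(2/\delta)\Big).$$ (ii) (Finite horizon.) If $\gamma_i=\dfrac{\gamma}{k^{1/p}}$ and $\lambda_i=\max\{(1+\varepsilon)L,\lambda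 k^{1/p}\}$ for $1\le i\le k$, then with probability at least $1-\delta$ $$f(\bar x_k)-f_*\le c\,\frac{1}{k^{(p-1)/p}}\Big(1+\log(2/\delta)\Big).$$ -/

import Mathlib

open MeasureTheory ProbabilityTheory
open scoped NNReal

noncomputable section

namespace ClippedSsGM

section Hilbert

variable {H : Type*} [NormedAddCommGroup H] [InnerProductSpace ℝ H]

/-- The subdifferential of `f` at `x`. -/
def subdifferential (f : H → ℝ) (x : H) : Set H :=
  {u | ∀ y, f x + inner ℝ u (y - x) ≤ f y}

/-- The metric projection onto `X`: a point of `X` at minimal distance from `x`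
(and `x` itself if there is none). -/
def proj (X : Set H) (x : H) : H :=
  open Classical in
  if h : ∃ y ∈ X, ∀ z ∈ X, ‖x - y‖ ≤ ‖x - z‖ then h.choose else x

/-- On a nonempty closed convex set the projection exists. -/
theorem proj_spec [CompleteSpace H] {X : Set H} (hne : X.Nonempty) (hc : IsClosed X)
    (hconv : Convex ℝ X) (x : H) :
    proj X x ∈ X ∧ ∀ z ∈ X, ‖x - proj X x‖ ≤ ‖x - z‖ := by
  have h : ∃ y ∈ X, ∀ z ∈ X, ‖x - y‖ ≤ ‖x - z‖ := by
    obtain ⟨y, hy, hmin⟩ := exists_norm_eq_iInf_of_complete_convex hne hc.isComplete hconv x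
    refine ⟨y, hy, fun z hz => ?_⟩
    rw [hmin]
    exact ciInf_le ⟨0, by rintro _ ⟨w, rfl⟩; exact norm_nonneg _⟩ (⟨z, hz⟩ : X)
  unfold proj
  rw [dif_pos h]
  exact h.choose_spec

/-- On a convex set the projection is the only point at minimal distance. -/
theorem proj_unique {X : Set H} (hconv : Convex ℝ X) {x y : H} (hy : y ∈ X)
    (hmin : ∀ z ∈ X, ‖x - y‖ ≤ ‖x - z‖) : proj X x = y := by
  have key : ∀ a ∈ X, (∀ z ∈ X, ‖x - a‖ ≤ ‖x - z‖) → ∀ w ∈ X, inner ℝ (x - a) (w - a) ≤ 0 := by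
    intro a ha hm
    refine (norm_eq_iInf_iff_real_inner_le_zero hconv ha).1 (le_antisymm ?_ ?_)
    · have : Nonempty X := ⟨⟨a, ha⟩⟩
      exact le_ciInf fun z => hm z z.2
    · exact ciInf_le ⟨0, by rintro _ ⟨w, rfl⟩; exact norm_nonneg _⟩ (⟨a, ha⟩ : X)
  have h : ∃ y ∈ X, ∀ z ∈ X, ‖x - y‖ ≤ ‖x - z‖ := ⟨y, hy, hmin⟩
  have hp : proj X x ∈ X ∧ ∀ z ∈ X, ‖x - proj X x‖ ≤ ‖x - z‖ := by
    unfold proj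
    rw [dif_pos h]
    exact h.choose_spec
  have h1 := key _ hp.1 hp.2 y hy
  have h2 := key y hy hmin _ hp.1
  have h3 : inner ℝ (proj X x - y) (proj X x - y) ≤ 0 := by
    have e : inner ℝ (proj X x - y) (proj X x - y)
        = inner ℝ (x - proj X x) (y - proj X x) + inner ℝ (x - y) (proj X x - y) := by
      have e1 : y - proj X x = -(proj X x - y) := by abel
      rw [e1, inner_neg_right, neg_add_eq_sub, ← inner_sub_left]
      congr 1
      abel
    linarith
  exact sub_eq_zero.1 (real_inner_self_nonpos.1 h3)

/-- The clipping operator `CLIP(u, r) = max{‖u‖ / r, 1}⁻¹ u`. -/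
def clip (u : H) (r : ℝ) : H := (max (‖u‖ / r) 1)⁻¹ • u

variable {Ω Ξ : Type*}

/-- The iterates of the clipped stochastic subgradient method with stepsizes `γ 1, γ 2, …`,
clipping levels `Λ 1, Λ 2, …`, batch size `m` and initial point `x₁`.  The iterate `x_{n+1}` is
`iterate … n`; the batch drawn at the `(n+1)`-st iteration is `ξs n`. -/
def iterate (X : Set H) (uhat : H → Ξ → H) (γ Λ : ℕ → ℝ) (m : ℕ) (ξs : ℕ → Fin m → Ω → Ξ)
    (x₁ : H) : ℕ → Ω → H
  | 0, _ => x₁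
  | n + 1, ω =>
    let x := iterate X uhat γ Λ m ξs x₁ n ω
    let ubar := (1 / (m : ℝ)) • ∑ j, uhat x (ξs n j ω)
    proj X (x - γ (n + 1) • clip ubar (Λ (n + 1)))

/-- The average `x̄_k = (x_1 + ⋯ + x_k) / k` of the first `k` iterates. -/
def average (X : Set H) (uhat : H → Ξ → H) (γ Λ : ℕ → ℝ) (m : ℕ) (ξs : ℕ → Fin m → Ω → Ξ)
    (x₁ : H) (k : ℕ) (ω : Ω) : H :=
  (1 / (k : ℝ)) • ∑ n ∈ Finset.range k, iterate X uhat γ Λ m ξs x₁ n ω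

/-- `uhat(·, ξ)` is an unbiased stochastic subgradient of `f` on `X` whose noise has its `p`-th
moment bounded by `σ ^ p`, uniformly over `X`. -/
structure IsStochasticSubgradient [MeasurableSpace H] [MeasurableSpace Ω] [MeasurableSpace Ξ]
    (P : Measure Ω) (f : H → ℝ) (X : Set H) (uhat : H → Ξ → H) (ξ : Ω → Ξ) (p σ : ℝ) :
    Prop where
  measurable_oracle : Measurable fun z : X × Ξ => uhat z.1 z.2
  measurable_variable : Measurable ξ
  integrable : ∀ x ∈ X, Integrable (fun ω => uhat x (ξ ω)) P
  mean_mem : ∀ x ∈ X, ∫ ω, uhat x (ξ ω) ∂P ∈ subdifferential f x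
  moment_integrable : ∀ x ∈ X,
    Integrable (fun ω => ‖uhat x (ξ ω) - ∫ ω', uhat x (ξ ω') ∂P‖ ^ p) P
  moment_le : ∀ x ∈ X, ∫ ω, ‖uhat x (ξ ω) - ∫ ω', uhat x (ξ ω') ∂P‖ ^ p ∂P ≤ σ ^ p

end Hilbert

/-- All the entries of all the batches are independent copies of `ξ`. -/
structure IsSampling {Ω Ξ : Type*} [MeasurableSpace Ω] [MeasurableSpace Ξ] (P : Measure Ω)
    (ξ : Ω → Ξ) (m : ℕ) (ξs : ℕ → Fin m → Ω → Ξ) : Prop where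
  measurable : ∀ n j, Measurable (ξs n j)
  identDistrib : ∀ n j, IdentDistrib (ξs n j) ξ P P
  indep : iIndepFun (fun (q : ℕ × Fin m) => ξs q.1 q.2) P

/-- Anytime stepsizes `γ_k = γ / (k (1 + log k))^{1/p}`. -/
def stepAT (p γ : ℝ) (k : ℕ) : ℝ := γ / ((k : ℝ) * (1 + Real.log k)) ^ (1 / p)

/-- Anytime clipping levels `λ_k = max{(1 + ε) L, λ (k (1 + log k))^{1/p}}`. -/
def clipAT (p L ε lam : ℝ) (k : ℕ) : ℝ :=
  max ((1 + ε) * L) (lam * ((k : ℝ) * (1 + Real.log k)) ^ (1 / p))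

/-- Finite-horizon stepsizes, with horizon `k`: constantly `γ / k^{1/p}`. -/
def stepFH (p γ : ℝ) (k : ℕ) (_i : ℕ) : ℝ := γ / (k : ℝ) ^ (1 / p)

/-- Finite-horizon clipping levels, with horizon `k`: constantly `max{(1 + ε) L, λ k^{1/p}}`. -/
def clipFH (p L ε lam : ℝ) (k : ℕ) (_i : ℕ) : ℝ := max ((1 + ε) * L) (lam * (k : ℝ) ^ (1 / p))

end ClippedSsGM

end

/-! Write the step as γ/a_n, with clipping level between lam·a_n and M·a_n, where M = (1+ε)L + lam.
Let d_n be the distance of the iterate to the minimizer. The projected step gives d_{n+1}² +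
2(γ/a_n)·gap_n ≤ d_n² + 2z_n, where the error z_n (`increment`) splits into a centred noise term,
the bias due to clipping, and a quadratic term.

Clipping makes z_n bounded by a multiple of γ(D+1) while d_n ≤ D. Bias and second-order terms both
cost a multiple of a_n^{-p} times L^p plus the p-th power of the noise. Hence e^y ≤ 1 + y + y²
bounds the conditional exponential moment of the rescaled error by exp(C·a_n^{-p})
(`exp_increment_le`, `lintegral_exp_increment_le`), although the noise may have infinite variance. A
Chernoff bound for the sum stopped at the exit from the ball of radius D
(`measure_stopped_sum_ge_le`) then bounds the accumulated error by a multiple of γ(D+1)(Cℓ + T),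
where ℓ bounds the sum of the a_n^{-p} and T = log(2/δ).

This bound is linear in D, while leaving the ball requires an error quadratic in D. So D
proportional to 1 + γℓ, with γT = 1, keeps the iterates in the ball (`le_of_stopped_sum_le`). The
same concentration for errors weighted by a_n/a_k ≤ 1, combined with Abel summation (`sum_gap_le`)
and Jensen's inequality, gives a gap of order (a_k/k)·D²/γ at the average. The union bound over the
two weightings accounts for δ = δ/2 + δ/2. The theorem is `rate` for two choices of a. -/

namespace ClippedSsGM

/-! ### Projection, clipping and the one-step energy inequality -/

section Hilbert

variable {H : Type*} [NormedAddCommGroup H] [InnerProductSpace ℝ H]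

theorem inner_sub_proj_le_zero [CompleteSpace H] {X : Set H} (hc : IsClosed X)
    (hconv : Convex ℝ X) (x : H) {w : H} (hw : w ∈ X) :
    inner ℝ (x - proj X x) (w - proj X x) ≤ 0 := by
  obtain ⟨hm, hmin⟩ := proj_spec ⟨w, hw⟩ hc hconv x
  refine (norm_eq_iInf_iff_real_inner_le_zero hconv hm).1 (le_antisymm ?_ ?_) w hw
  · have : Nonempty X := ⟨⟨w, hw⟩⟩
    exact le_ciInf fun z => hmin z z.2
  · exact ciInf_le ⟨0, by rintro _ ⟨w, rfl⟩; exact norm_nonneg _⟩ (⟨_, hm⟩ : X)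

theorem norm_proj_sub_proj_le [CompleteSpace H] {X : Set H} (hne : X.Nonempty) (hc : IsClosed X)
    (hconv : Convex ℝ X) (x y : H) : ‖proj X x - proj X y‖ ≤ ‖x - y‖ := by
  have hx := (proj_spec hne hc hconv x).1
  have hy := (proj_spec hne hc hconv y).1
  have h1 := inner_sub_proj_le_zero hc hconv x hy
  have h2 := inner_sub_proj_le_zero hc hconv y hx
  have e : inner ℝ (proj X x - proj X y) (proj X x - proj X y)
      = inner ℝ (x - y) (proj X x - proj X y) + inner ℝ (x - proj X x) (proj X y - proj X x)
        + inner ℝ (y - proj X y) (proj X x - proj X y) := by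
    simp only [inner_sub_left, inner_sub_right]
    ring
  have h3 := real_inner_le_norm (x - y) (proj X x - proj X y)
  rw [real_inner_self_eq_norm_sq] at e
  by_contra! hlt
  have := norm_nonneg (x - y)
  nlinarith

theorem continuous_proj [CompleteSpace H] {X : Set H} (hne : X.Nonempty) (hc : IsClosed X)
    (hconv : Convex ℝ X) : Continuous (proj X) :=
  (LipschitzWith.of_dist_le_mul (K := 1) fun x y => by
    simpa [dist_eq_norm] using norm_proj_sub_proj_le hne hc hconv x y).continuous

theorem norm_proj_sub_le [CompleteSpace H] {X : Set H} (hc : IsClosed X)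
    (hconv : Convex ℝ X) (x : H) {w : H} (hw : w ∈ X) : ‖proj X x - w‖ ≤ ‖x - w‖ := by
  have h := norm_proj_sub_proj_le ⟨w, hw⟩ hc hconv x w
  rwa [proj_unique hconv hw (x := w) (by simp)] at h

theorem continuous_clip (r : ℝ) : Continuous fun u : H => clip u r := by
  unfold clip
  refine Continuous.smul (Continuous.inv₀ (by fun_prop) fun u => ?_) continuous_id
  exact (lt_of_lt_of_le one_pos (le_max_right _ _)).ne'

theorem clip_of_le {u : H} {r : ℝ} (hr : 0 < r) (h : ‖u‖ ≤ r) : clip u r = u := by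
  rw [clip, max_eq_right ((div_le_one hr).2 h), inv_one, one_smul]

theorem clip_of_ge {u : H} {r : ℝ} (hr : 0 < r) (h : r ≤ ‖u‖) : clip u r = (r / ‖u‖) • u := by
  rw [clip, max_eq_left ((one_le_div hr).2 h), inv_div]

theorem norm_clip_le {u : H} {r : ℝ} (hr : 0 < r) : ‖clip u r‖ ≤ r := by
  rcases le_total ‖u‖ r with h | h
  · rwa [clip_of_le hr h]
  · have := hr.trans_le h
    rw [clip_of_ge hr h, norm_smul, Real.norm_of_nonneg (by positivity), div_mul_cancel₀ _ this.ne']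

theorem norm_clip_le_norm (u : H) (r : ℝ) : ‖clip u r‖ ≤ ‖u‖ := by
  have h1 : 1 ≤ max (‖u‖ / r) 1 := le_max_right _ _
  rw [clip, norm_smul, norm_inv, Real.norm_of_nonneg (by linarith)]
  exact mul_le_of_le_one_left (norm_nonneg _) (inv_le_one_of_one_le₀ h1)

theorem norm_sub_clip {u : H} {r : ℝ} (hr : 0 < r) (h : r ≤ ‖u‖) : ‖u - clip u r‖ = ‖u‖ - r := by
  have hu := hr.trans_le h
  have e : u - clip u r = (1 - r / ‖u‖) • u := by rw [clip_of_ge hr h, sub_smul, one_smul]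
  have : 0 ≤ 1 - r / ‖u‖ := by rw [sub_nonneg]; exact (div_le_one hu).2 h
  rw [e, norm_smul, Real.norm_of_nonneg this]
  field_simp

/-- The clipping bias is controlled pointwise by the `p`-th power of the noise. -/
theorem norm_sub_clip_le {p ε L r : ℝ} (hp : 1 ≤ p) (hε : 0 < ε) (hL : 0 < L)
    (hr : (1 + ε) * L ≤ r) {u v : H} (hu : ‖u‖ ≤ L) :
    ‖v - clip v r‖ ≤ (ε / (1 + ε) * r) ^ (1 - p) * ‖v - u‖ ^ p := by
  have hr0 : 0 < r := lt_of_lt_of_le (by positivity) hr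
  rcases le_total ‖v‖ r with h | h
  · rw [clip_of_le hr0 h, sub_self, norm_zero]
    positivity
  rw [norm_sub_clip hr0 h]
  set t := ‖v - u‖ with ht
  have h1 : ‖v‖ - L ≤ t := by linarith [norm_sub_norm_le v u]
  have h2 : L ≤ r / (1 + ε) := by rw [le_div_iff₀ (by positivity)]; linarith
  have h3 : ε / (1 + ε) * r = r - r / (1 + ε) := by field_simp; ring
  have h5 : 0 < ε / (1 + ε) * r := by positivity
  -- If clipping is active then the noise is large: t ≥ r - L, and the margin (1+ε)L ≤ r makes this
  -- a fixed fraction of r. Then t^(1-p) can be replaced by its value at that threshold.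
  have h4 : ε / (1 + ε) * r ≤ t := by linarith
  have ht0 : 0 < t := h5.trans_le h4
  have hrp : 0 ≤ r / (1 + ε) := by positivity
  calc ‖v‖ - r ≤ t := by linarith
    _ = t ^ (1 - p) * t ^ p := by rw [← Real.rpow_add ht0]; simp
    _ ≤ _ := mul_le_mul_of_nonneg_right
      (Real.rpow_le_rpow_of_nonpos h5 h4 (by linarith)) (by positivity)

theorem sq_le_rpow_mul_rpow {p t r : ℝ} (hp : p ≤ 2) (ht : 0 ≤ t) (h : t ≤ r) :
    t ^ 2 ≤ r ^ (2 - p) * t ^ p := by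
  rcases ht.eq_or_lt with rfl | ht
  · have := Real.rpow_nonneg h (2 - p)
    have := Real.rpow_nonneg le_rfl p
    rw [zero_pow two_ne_zero]
    positivity
  · calc t ^ 2 = t ^ (2 - p) * t ^ p := by rw [← Real.rpow_add ht]; norm_num
      _ ≤ _ := by gcongr

theorem add_rpow_le_two_mul {p x y : ℝ} (hp : 1 ≤ p) (hp₂ : p ≤ 2) (hx : 0 ≤ x) (hy : 0 ≤ y) :
    (x + y) ^ p ≤ 2 * (x ^ p + y ^ p) := by
  have h := (convexOn_rpow hp).2 (Set.mem_Ici.2 hx) (Set.mem_Ici.2 hy)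
    (by norm_num : (0 : ℝ) ≤ 1 / 2) (by norm_num : (0 : ℝ) ≤ 1 / 2) (by norm_num)
  simp only [smul_eq_mul] at h
  have e : x + y = 2 * (1 / 2 * x + 1 / 2 * y) := by ring
  have h2 : (2 : ℝ) ^ p ≤ 4 := by
    calc (2 : ℝ) ^ p ≤ 2 ^ (2 : ℝ) := Real.rpow_le_rpow_of_exponent_le (by norm_num) hp₂
      _ = 4 := by norm_num
  rw [e, Real.mul_rpow (by norm_num) (by positivity)]
  calc _ ≤ 4 * (1 / 2 * x ^ p + 1 / 2 * y ^ p) := by gcongr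
    _ = _ := by ring

/-- Boundedness by r pays for the powers beyond the p-th, so a second-moment quantity is controlled
by p-th moments alone. -/
theorem sq_norm_clip_le {p L r : ℝ} (hp : 1 ≤ p) (hp₂ : p ≤ 2) (hL : 0 ≤ L) (hr : 0 < r)
    {u v : H} (hu : ‖u‖ ≤ L) :
    ‖clip v r‖ ^ 2 ≤ 2 * r ^ (2 - p) * (L ^ p + ‖v - u‖ ^ p) := by
  have h1 : ‖clip v r‖ ≤ L + ‖v - u‖ := by
    have := norm_clip_le_norm v r
    have := norm_le_norm_add_norm_sub' v u
    linarith
  calc ‖clip v r‖ ^ 2 ≤ r ^ (2 - p) * ‖clip v r‖ ^ p :=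
        sq_le_rpow_mul_rpow hp₂ (norm_nonneg _) (norm_clip_le hr)
    _ ≤ r ^ (2 - p) * (2 * (L ^ p + ‖v - u‖ ^ p)) := by
        gcongr
        exact (Real.rpow_le_rpow (norm_nonneg _) h1 (by linarith)).trans
          (add_rpow_le_two_mul hp hp₂ hL (norm_nonneg _))
    _ = _ := by ring

/-- Test the subgradient inequality at x + u: it gives ‖u‖² ≤ L‖u‖. -/
theorem norm_le_of_mem_subdifferential {f : H → ℝ} {L : ℝ≥0} (hf : LipschitzWith L f) {x u : H}
    (hu : u ∈ subdifferential f x) : ‖u‖ ≤ L := by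
  have h1 := hu (x + u)
  have h2 := hf.dist_le_mul (x + u) x
  rw [Real.dist_eq, dist_eq_norm] at h2
  rw [add_sub_cancel_left] at h1 h2
  rw [real_inner_self_eq_norm_sq] at h1
  have h3 := le_abs_self (f (x + u) - f x)
  by_contra! hlt
  have : (0 : ℝ) ≤ L := L.2
  nlinarith

/-- The basic energy inequality of the projected subgradient step. -/
theorem sq_norm_proj_step_le [CompleteSpace H] {X : Set H} (hc : IsClosed X) (hconv : Convex ℝ X)
    {f : H → ℝ} {x xs u : H} (hxs : xs ∈ X) (hu : u ∈ subdifferential f x) (g : H) {t : ℝ}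
    (ht : 0 ≤ t) :
    ‖proj X (x - t • g) - xs‖ ^ 2 + 2 * t * (f x - f xs)
      ≤ ‖x - xs‖ ^ 2 + 2 * (t * inner ℝ (u - g) (x - xs) + t ^ 2 * ‖g‖ ^ 2 / 2) := by
  have h1 := norm_proj_sub_le hc hconv (x - t • g) hxs
  have h2 : ‖proj X (x - t • g) - xs‖ ^ 2 ≤ ‖x - t • g - xs‖ ^ 2 := by gcongr
  have e : x - t • g - xs = (x - xs) - t • g := by abel
  have h3 : ‖x - t • g - xs‖ ^ 2
      = ‖x - xs‖ ^ 2 - 2 * t * inner ℝ g (x - xs) + t ^ 2 * ‖g‖ ^ 2 := by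
    rw [e, norm_sub_sq_real, real_inner_smul_right, real_inner_comm, norm_smul, mul_pow,
      Real.norm_eq_abs, sq_abs]
    ring
  have h4 := hu xs
  rw [← neg_sub x xs, inner_neg_right] at h4
  rw [inner_sub_left]
  nlinarith

end Hilbert

/-! ### Deterministic inequalities for sequences -/

section Deterministic

/-- At a first exit time n the stopped sum is exactly the sum of z over i < n, which by the energy
inequality is too small for d n to exceed D. -/
theorem le_of_stopped_sum_le {d z : ℕ → ℝ} {D B R : ℝ} {k : ℕ} (hd : ∀ n, 0 ≤ d n) (hD : 0 ≤ D)
    (h0 : d 0 ≤ R) (hstep : ∀ n, d (n + 1) ^ 2 ≤ d n ^ 2 + 2 * z n)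
    (hsum : ∑ n ∈ Finset.range k, (if ∀ j ≤ n, d j ≤ D then z n else 0) ≤ B)
    (hB : R ^ 2 + 2 * B ≤ D ^ 2) : ∀ n ≤ k, d n ≤ D := by
  intro n
  induction n using Nat.strong_induction_on with
  | _ n ih =>
    intro hn
    by_contra! hlt
    have h1 : ∑ i ∈ Finset.range k, (if ∀ j ≤ i, d j ≤ D then z i else 0)
        = ∑ i ∈ Finset.range n, z i := by
      rw [← Finset.sum_subset (Finset.range_mono hn)]
      · refine Finset.sum_congr rfl fun i hi => if_pos fun j hj => ?_
        have := Finset.mem_range.1 hi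
        exact ih j (by omega) (by omega)
      · intro i _ hi
        refine if_neg fun h => ?_
        exact absurd (h n (by simpa using hi)) (not_le.2 hlt)
    have h2 : ∀ i, d i ^ 2 ≤ d 0 ^ 2 + 2 * ∑ j ∈ Finset.range i, z j := by
      intro i
      induction i with
      | zero => simp
      | succ i ihi =>
        rw [Finset.sum_range_succ]
        linarith [hstep i]
    have h3 := h2 n
    have h4 : d 0 ^ 2 ≤ R ^ 2 := pow_le_pow_left₀ (hd 0) h0 2
    nlinarith

/-- Abel summation: each increase of the weight multiplies a value e n ≤ E. -/
theorem sum_mul_sub_le {a e : ℕ → ℝ} {E : ℝ} (ha : Monotone a) (ha0 : 0 ≤ a 0) :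
    ∀ k, (∀ n ≤ k, e n ≤ E) →
      ∑ n ∈ Finset.range (k + 1), a n * (e n - e (n + 1)) ≤ a k * (E - e (k + 1)) := by
  intro k
  induction k with
  | zero =>
    intro h
    have := h 0 le_rfl
    simp only [zero_add, Finset.sum_range_one]
    gcongr
  | succ k ih =>
    intro h
    rw [Finset.sum_range_succ]
    have h1 := ih fun n hn => h n (by omega)
    have h2 := h (k + 1) le_rfl
    have h3 := ha (Nat.le_succ k)
    nlinarith

/-- Multiplying the energy inequality by a n equalizes the coefficients of the gaps, as needed for a
uniform average. The errors acquire the weights a n, normalized here by a k so that they are at most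
1. -/
theorem sum_gap_le {a d g z : ℕ → ℝ} {γ D B : ℝ} {k : ℕ} (ha : Monotone a) (ha0 : 0 < a 0)
    (hγ : 0 < γ) (hd : ∀ n, 0 ≤ d n) (hdD : ∀ n ≤ k, d n ≤ D)
    (hstep : ∀ n, d (n + 1) ^ 2 + 2 * (γ / a n) * g n ≤ d n ^ 2 + 2 * z n)
    (hsum : ∑ n ∈ Finset.range (k + 1), a n / a k * z n ≤ B) :
    2 * γ * ∑ n ∈ Finset.range (k + 1), g n ≤ a k * (D ^ 2 + 2 * B) := by
  have hpos : ∀ n, 0 < a n := fun n => ha0.trans_le (ha (Nat.zero_le n))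
  have h1 := sum_mul_sub_le (e := fun n => d n ^ 2) (E := D ^ 2) ha ha0.le k
    fun n hn => pow_le_pow_left₀ (hd n) (hdD n hn) 2
  have h2 : ∀ n, 2 * γ * g n ≤ a n * (d n ^ 2 - d (n + 1) ^ 2) + a k * (2 * (a n / a k * z n)) := by
    intro n
    have e : a k * (2 * (a n / a k * z n)) = a n * (2 * z n) := by
      field_simp [(hpos k).ne']
    have e' : 2 * γ * g n = a n * (2 * (γ / a n) * g n) := by
      field_simp [(hpos n).ne']
    rw [e, e', ← mul_add]
    exact mul_le_mul_of_nonneg_left (by linarith [hstep n]) (hpos n).le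
  have h3 := Finset.sum_le_sum fun n (_ : n ∈ Finset.range (k + 1)) => h2 n
  rw [← Finset.mul_sum, Finset.sum_add_distrib, ← Finset.mul_sum, ← Finset.mul_sum] at h3
  have h4 := mul_le_mul_of_nonneg_left hsum (hpos k).le
  nlinarith [mul_nonneg (hpos k).le (sq_nonneg (d (k + 1)))]

/-- The summand is the derivative of log(1 + log x). The comparison of each term with a telescoping
difference comes from 1 - 1/y ≤ log y, used once for each logarithm. -/
theorem sum_inv_mul_one_add_log_le (k : ℕ) :
    ∑ n ∈ Finset.range (k + 1), (((n + 1 : ℕ) : ℝ) * (1 + Real.log (n + 1 : ℕ)))⁻¹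
      ≤ 1 + Real.log (1 + Real.log (k + 1 : ℕ)) := by
  induction k with
  | zero => simp
  | succ k ih =>
    rw [Finset.sum_range_succ]
    set s : ℝ := ((k + 1 : ℕ) : ℝ) with hs
    have hs1 : 1 ≤ s := by simp [hs]
    have e : ((k + 1 + 1 : ℕ) : ℝ) = s + 1 := by simp [hs]
    rw [e]
    have hx : 0 < 1 + Real.log s := by linarith [Real.log_nonneg hs1]
    have hy : 0 < 1 + Real.log (s + 1) := by linarith [Real.log_nonneg (x := s + 1) (by linarith)]
    have h1 := Real.one_sub_inv_le_log_of_pos (div_pos hy hx)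
    have h2 := Real.one_sub_inv_le_log_of_pos (x := (s + 1) / s) (by positivity)
    rw [Real.log_div hy.ne' hx.ne', inv_div] at h1
    rw [Real.log_div (by positivity) (by positivity), inv_div] at h2
    have h3 : ((s + 1) * (1 + Real.log (s + 1)))⁻¹
        ≤ 1 - (1 + Real.log s) / (1 + Real.log (s + 1)) := by
      rw [mul_inv, one_sub_div hy.ne', div_eq_mul_inv]
      gcongr
      calc (s + 1)⁻¹ = 1 - s / (s + 1) := by field_simp; ring
        _ ≤ _ := by linarith
    linarith

end Deterministic

/-! ### Exponential concentration of stopped adapted sums -/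

section Concentration

open scoped ENNReal

variable {Ω S T : Type*} [MeasurableSpace S] [MeasurableSpace T]

/-- By independence and Tonelli, a past-measurable state can be frozen while the fresh sample is
integrated out; this plays the role of conditional expectation. -/
theorem lintegral_mul_comp_of_indep {𝓖 mΩ : MeasurableSpace Ω} {P : Measure Ω}
    [IsProbabilityMeasure P] (h𝓖 : 𝓖 ≤ mΩ) {x : Ω → S} {b : Ω → T} {V : Ω → ℝ≥0∞}
    (hx : Measurable[𝓖] x) (hV : Measurable[𝓖] V) (hb : Measurable b)
    (hind : Indep 𝓖 (MeasurableSpace.comap b inferInstance) P) {g : S × T → ℝ≥0∞}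
    (hg : Measurable g) :
    ∫⁻ ω, V ω * g (x ω, b ω) ∂P = ∫⁻ ω, V ω * ∫⁻ ω', g (x ω, b ω') ∂P ∂P := by
  have hY : Measurable[𝓖] fun ω => (x ω, V ω) := hx.prodMk hV
  have hY' : Measurable fun ω => (x ω, V ω) := hY.mono h𝓖 le_rfl
  have hi : IndepFun (fun ω => (x ω, V ω)) b P := by
    rw [IndepFun_iff_Indep]
    exact indep_of_indep_of_le_left hind hY.comap_le
  have hmap := (indepFun_iff_map_prod_eq_prod_map_map hY'.aemeasurable hb.aemeasurable).1 hi
  have hG : Measurable fun q : (S × ℝ≥0∞) × T => q.1.2 * g (q.1.1, q.2) := by fun_prop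
  calc ∫⁻ ω, V ω * g (x ω, b ω) ∂P
      = ∫⁻ q, q.1.2 * g (q.1.1, q.2) ∂(P.map fun ω => ((x ω, V ω), b ω)) := by
        rw [lintegral_map hG (hY'.prodMk hb)]
    _ = ∫⁻ y, ∫⁻ t, y.2 * g (y.1, t) ∂(P.map b) ∂(P.map fun ω => (x ω, V ω)) := by
        have : IsProbabilityMeasure (P.map b) := Measure.isProbabilityMeasure_map hb.aemeasurable
        rw [hmap, lintegral_prod _ hG.aemeasurable]
    _ = ∫⁻ ω, ∫⁻ t, V ω * g (x ω, t) ∂(P.map b) ∂P := by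
        have : IsProbabilityMeasure (P.map b) := Measure.isProbabilityMeasure_map hb.aemeasurable
        rw [lintegral_map hG.lintegral_prod_right' hY']
    _ = _ := by
        refine lintegral_congr fun ω => ?_
        have : Measurable fun t => g (x ω, t) := by fun_prop
        rw [lintegral_const_mul _ this, lintegral_map this hb]

/-- An exponential tail bound for an adapted sum that is stopped when the state leaves a set. -/
theorem measure_stopped_sum_ge_le {mΩ : MeasurableSpace Ω} {P : Measure Ω} [IsProbabilityMeasure P]
    {𝓕 : ℕ → MeasurableSpace Ω} (h𝓕 : ∀ n, 𝓕 n ≤ mΩ) (hmono : Monotone 𝓕) {x : ℕ → Ω → S}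
    {b : ℕ → Ω → T} (hx : ∀ n, Measurable[𝓕 n] (x n)) (hb : ∀ n, Measurable[𝓕 (n + 1)] (b n))
    (hind : ∀ n, Indep (𝓕 n) (MeasurableSpace.comap (b n) inferInstance) P) {ζ : ℕ → S × T → ℝ}
    (hζ : ∀ n, Measurable (ζ n)) {G : S → Prop} [DecidablePred G] (hG : MeasurableSet {y | G y})
    {c : ℕ → ℝ} (hc : ∀ n, 0 ≤ c n)
    (hexp : ∀ n y, G y →
      ∫⁻ ω, ENNReal.ofReal (Real.exp (ζ n (y, b n ω))) ∂P ≤ ENNReal.ofReal (Real.exp (c n)))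
    (k : ℕ) (t : ℝ) :
    P {ω | ∑ n ∈ Finset.range k, c n + t
        ≤ ∑ n ∈ Finset.range k, if ∀ j ≤ n, G (x j ω) then ζ n (x n ω, b n ω) else 0}
      ≤ ENNReal.ofReal (Real.exp (-t)) := by
  set M : ℕ → Ω → ℝ := fun k ω =>
    ∑ n ∈ Finset.range k, if ∀ j ≤ n, G (x j ω) then ζ n (x n ω, b n ω) else 0 with hM
  have hA : ∀ n, MeasurableSet[𝓕 n] {ω | ∀ j ≤ n, G (x j ω)} := by
    intro n
    have e : {ω | ∀ j ≤ n, G (x j ω)} = ⋂ j ∈ Set.Iic n, (x j) ⁻¹' {y | G y} := by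
      ext ω
      simp
    rw [e]
    exact MeasurableSet.biInter (Set.to_countable _) fun j hj =>
      hmono (Set.mem_Iic.1 hj) _ (hx j hG)
  have hMm : ∀ k, Measurable[𝓕 k] (M k) := by
    intro k
    refine Finset.measurable_sum _ fun n hn => ?_
    have hn := Finset.mem_range.1 hn
    refine Measurable.ite (hmono hn.le _ (hA n)) ?_ measurable_const
    exact (hζ n).comp (((hx n).mono (hmono hn.le) le_rfl).prodMk
      ((hb n).mono (hmono hn) le_rfl))
  have hEk : ∀ k, ∫⁻ ω, ENNReal.ofReal (Real.exp (M k ω)) ∂P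
      ≤ ENNReal.ofReal (Real.exp (∑ n ∈ Finset.range k, c n)) := by
    intro k
    induction k with
    | zero => simp [hM]
    | succ k ih =>
      set A := {ω | ∀ j ≤ k, G (x j ω)} with hAdef
      set W : Ω → ℝ≥0∞ := fun ω => ENNReal.ofReal (Real.exp (M k ω)) with hW
      have hWm : Measurable[𝓕 k] W := (Real.measurable_exp.comp (hMm k)).ennreal_ofReal
      have hVm : Measurable[𝓕 k] (A.indicator W) := hWm.indicator (hA k)
      have hUm : Measurable (Aᶜ.indicator W) :=
        (hWm.indicator (hA k).compl).mono (h𝓕 k) le_rfl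
      have hgm : Measurable fun q => ENNReal.ofReal (Real.exp (ζ k q)) :=
        (Real.measurable_exp.comp (hζ k)).ennreal_ofReal
      -- Once the state has left the set, the sum no longer changes; otherwise the exponential gains
      -- one factor driven by the fresh sample.
      have h1 : ∀ ω, ENNReal.ofReal (Real.exp (M (k + 1) ω))
          = Aᶜ.indicator W ω
            + A.indicator W ω * ENNReal.ofReal (Real.exp (ζ k (x k ω, b k ω))) := by
        intro ω
        simp only [hM, Finset.sum_range_succ]
        by_cases hω : ω ∈ A
        · rw [if_pos (show ∀ j ≤ k, G (x j ω) from hω), Set.indicator_of_notMem (by simpa using hω), zero_add,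
            Set.indicator_of_mem hω, Real.exp_add, ENNReal.ofReal_mul (Real.exp_nonneg _)]
        · rw [if_neg (show ¬ ∀ j ≤ k, G (x j ω) from hω), Set.indicator_of_mem (by simpa using hω), Set.indicator_of_notMem hω,
            zero_mul, add_zero, add_zero]
      have hbm : Measurable (b k) := (hb k).mono (h𝓕 _) le_rfl
      calc ∫⁻ ω, ENNReal.ofReal (Real.exp (M (k + 1) ω)) ∂P
          = ∫⁻ ω, Aᶜ.indicator W ω ∂P
            + ∫⁻ ω, A.indicator W ω * ∫⁻ ω', ENNReal.ofReal (Real.exp (ζ k (x k ω, b k ω'))) ∂P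
              ∂P := by
            rw [lintegral_congr h1, lintegral_add_left hUm,
              lintegral_mul_comp_of_indep (h𝓕 k) (hx k) hVm hbm (hind k) hgm]
        _ ≤ ∫⁻ ω, Aᶜ.indicator W ω * ENNReal.ofReal (Real.exp (c k)) ∂P
            + ∫⁻ ω, A.indicator W ω * ENNReal.ofReal (Real.exp (c k)) ∂P := by
            refine add_le_add (lintegral_mono fun ω => ?_) (lintegral_mono fun ω => ?_)
            -- On the stopped event the factor exp(c k) is inserted for free since c k ≥ 0, so both
            -- events carry the same factor and recombine.
            · refine le_mul_of_one_le_right' ?_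
              rw [← ENNReal.ofReal_one]
              exact ENNReal.ofReal_le_ofReal (Real.one_le_exp (hc k))
            · by_cases hω : ω ∈ A
              · gcongr
                exact hexp k _ ((show ∀ j ≤ k, G (x j ω) from hω) k le_rfl)
              · simp [Set.indicator_of_notMem hω]
        _ = ∫⁻ ω, W ω * ENNReal.ofReal (Real.exp (c k)) ∂P := by
            rw [← lintegral_add_left (hUm.mul_const _)]
            refine lintegral_congr fun ω => ?_
            rw [← add_mul, Set.indicator_compl_add_self_apply]
        _ ≤ ENNReal.ofReal (Real.exp (∑ n ∈ Finset.range k, c n))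
            * ENNReal.ofReal (Real.exp (c k)) := by
            rw [lintegral_mul_const _ (hWm.mono (h𝓕 k) le_rfl)]
            gcongr
        _ = _ := by
            rw [← ENNReal.ofReal_mul (Real.exp_nonneg _), ← Real.exp_add, Finset.sum_range_succ]
  set C := ∑ n ∈ Finset.range k, c n
  have hm : Measurable fun ω => ENNReal.ofReal (Real.exp (M k ω)) :=
    ((Real.measurable_exp.comp ((hMm k).mono (h𝓕 k) le_rfl))).ennreal_ofReal
  have h2 := mul_meas_ge_le_lintegral (μ := P) hm (ENNReal.ofReal (Real.exp (C + t)))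
  have h3 : {ω | C + t ≤ M k ω}
      ⊆ {ω | ENNReal.ofReal (Real.exp (C + t)) ≤ ENNReal.ofReal (Real.exp (M k ω))} :=
    fun ω hω => ENNReal.ofReal_le_ofReal (Real.exp_le_exp.2 hω)
  have hne : ENNReal.ofReal (Real.exp (C + t)) ≠ 0 := by
    simpa using Real.exp_pos _
  calc P {ω | C + t ≤ M k ω}
      ≤ P {ω | ENNReal.ofReal (Real.exp (C + t)) ≤ ENNReal.ofReal (Real.exp (M k ω))} :=
        measure_mono h3
    _ ≤ ENNReal.ofReal (Real.exp C) / ENNReal.ofReal (Real.exp (C + t)) := by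
        rw [ENNReal.le_div_iff_mul_le (Or.inl hne) (Or.inl ENNReal.ofReal_ne_top), mul_comm]
        exact h2.trans (hEk k)
    _ = _ := by
        rw [← ENNReal.ofReal_div_of_pos (Real.exp_pos _), ← Real.exp_sub]
        congr 2
        ring

end Concentration

/-! ### Independence of a batch from the past -/

section Past

/-- The σ-algebra generated by the samples drawn before step `n`. -/
@[reducible] def past {Ω Ξ : Type*} [MeasurableSpace Ξ] {m : ℕ} (ξs : ℕ → Fin m → Ω → Ξ) (n : ℕ) :
    MeasurableSpace Ω :=
  ⨆ q ∈ {q : ℕ × Fin m | q.1 < n}, MeasurableSpace.comap (ξs q.1 q.2) inferInstance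

variable {Ω Ξ : Type*} {mΩ : MeasurableSpace Ω} [MeasurableSpace Ξ] {P : Measure Ω} {ξ : Ω → Ξ}
  {m : ℕ} {ξs : ℕ → Fin m → Ω → Ξ}

theorem past_le (h : ∀ n j, Measurable (ξs n j)) (n : ℕ) : past ξs n ≤ mΩ :=
  iSup₂_le fun q _ => (h q.1 q.2).comap_le

theorem past_mono : Monotone (past ξs) := fun _ _ hab =>
  biSup_mono fun _ hq => lt_of_lt_of_le hq hab

theorem measurable_batch_past (n : ℕ) :
    Measurable[past ξs (n + 1)] fun ω (j : Fin m) => ξs n j ω := by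
  refine @measurable_pi_lambda _ _ _ (past ξs (n + 1)) _ _ fun j => ?_
  refine Measurable.of_comap_le ?_
  exact le_biSup (fun q : ℕ × Fin m => MeasurableSpace.comap (ξs q.1 q.2) inferInstance)
    (i := (n, j)) (Nat.lt_succ_self n)

theorem IsSampling.indep_past (h : IsSampling P ξ m ξs) (n : ℕ) :
    Indep (past ξs n) (MeasurableSpace.comap (fun ω (j : Fin m) => ξs n j ω) inferInstance) P := by
  have hd : Disjoint {q : ℕ × Fin m | q.1 < n} {q : ℕ × Fin m | q.1 = n} := by
    rw [Set.disjoint_left]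
    intro q hq hq'
    exact absurd hq' (ne_of_lt hq)
  have h1 := indep_iSup_of_disjoint (m := fun q : ℕ × Fin m =>
    MeasurableSpace.comap (ξs q.1 q.2) inferInstance)
    (fun q => (h.measurable q.1 q.2).comap_le) h.indep.iIndep hd
  refine indep_of_indep_of_le_right h1 ?_
  set 𝓖 : MeasurableSpace Ω := ⨆ q ∈ {q : ℕ × Fin m | q.1 = n},
    MeasurableSpace.comap (ξs q.1 q.2) inferInstance
  have h2 : ∀ j : Fin m, Measurable[𝓖] (ξs n j) := fun j => by
    refine Measurable.of_comap_le ?_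
    exact le_biSup (fun q : ℕ × Fin m => MeasurableSpace.comap (ξs q.1 q.2) inferInstance)
      (i := (n, j)) rfl
  have h3 : Measurable[𝓖] fun ω (j : Fin m) => ξs n j ω :=
    @measurable_pi_lambda _ _ _ 𝓖 _ _ h2
  exact h3.comap_le

end Past

/-! ### Exponential bound for a single increment -/

section Increment

variable {H : Type*} [NormedAddCommGroup H] [InnerProductSpace ℝ H]

/-- The error term of a clipped step of length `t` at level `r`, in the direction `η`, where `u` is
the true subgradient and `v` its estimate. -/
noncomputable def increment (t r : ℝ) (u v η : H) : ℝ :=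
  t * inner ℝ (u - clip v r) η + t ^ 2 * ‖clip v r‖ ^ 2 / 2

theorem increment_le {t r : ℝ} (ht : 0 ≤ t) (u v η : H) :
    increment t r u v η ≤ t * inner ℝ (u - v) η + t * ‖v - clip v r‖ * ‖η‖
      + t ^ 2 * ‖clip v r‖ ^ 2 / 2 := by
  have e : u - clip v r = (u - v) + (v - clip v r) := by abel
  have h := real_inner_le_norm (v - clip v r) η
  rw [increment, e, inner_add_left, mul_add, mul_assoc t ‖_‖]
  gcongr

theorem abs_increment_le {t r : ℝ} (ht : 0 ≤ t) (u v η : H) :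
    |increment t r u v η| ≤ t * ‖u - clip v r‖ * ‖η‖ + t ^ 2 * ‖clip v r‖ ^ 2 / 2 := by
  have h := abs_real_inner_le_norm (u - clip v r) η
  refine (abs_add_le _ _).trans (add_le_add ?_ (abs_of_nonneg (by positivity)).le)
  rw [abs_mul, abs_of_nonneg ht, mul_assoc]
  gcongr

/-- The scale of the increments, when the clipping levels are at most `M` times the inverse step. -/
def scaleConst (M : ℝ) : ℝ := 1 + 2 * M + M ^ 2

/-- The constant of the exponential moment bound for the increments. -/
noncomputable def momentConst (p ε lam M : ℝ) : ℝ :=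
  (ε / (1 + ε) * lam) ^ (1 - p) + (9 + M ^ 2) * (2 * M ^ (2 - p))

/-- Scalar core of `exp_increment_le`: e is the centred noise, g the bias, x and y the sizes of the
linear and quadratic parts, and Q carries the p-th moment. The scaling gives |s z| ≤ 1, so e^y ≤ 1 +
y + y² applies; the first-order part contributes K₁ + K₂ and the square (8 + M²)K₂. -/
theorem exp_le_of_scaled_bounds {M γ D ρ K₁ K₂ Q x y g e h z : ℝ} (hM : 0 < M) (hγ : 0 < γ)
    (hγ₁ : γ ≤ 1) (hD : 0 ≤ D) (hρ : 0 ≤ ρ) (hρ₁ : ρ ≤ 1) (hK₁ : 0 ≤ K₁) (hK₂ : 0 ≤ K₂)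
    (hQ : 0 ≤ Q) (hx0 : 0 ≤ x) (hy0 : 0 ≤ y) (hh0 : 0 ≤ h) (hh : h ≤ D)
    (hx : x ≤ 2 * (γ * M)) (hy : y ≤ γ * M) (hg : g ≤ γ * (K₁ * Q))
    (hy2 : y ^ 2 ≤ γ ^ 2 * (K₂ * Q)) (hx2 : x ^ 2 ≤ 4 * (γ ^ 2 * (K₂ * Q)))
    (hzabs : |z| ≤ x * h + y ^ 2 / 2) (hzle : z ≤ e + g * h + y ^ 2 / 2) :
    Real.exp (ρ / (scaleConst M * γ * (D + 1)) * z)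
      ≤ 1 + ρ / (scaleConst M * γ * (D + 1)) * e + (K₁ + (9 + M ^ 2) * K₂) * Q := by
  have hb1 : 1 ≤ scaleConst M := by rw [scaleConst]; nlinarith
  have hy2' : y ^ 2 ≤ γ * M ^ 2 := by
    calc y ^ 2 ≤ (γ * M) ^ 2 := by gcongr
      _ = γ * (γ * M ^ 2) := by ring
      _ ≤ γ * M ^ 2 := mul_le_of_le_one_left (by positivity) hγ₁
  have hA : |z| ≤ γ * (D + 1) * scaleConst M := by
    have : x * h ≤ 2 * (γ * M) * D := by gcongr
    rw [scaleConst]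
    have e1 : 0 ≤ γ * D := by positivity
    have e2 : 0 ≤ γ * D * M ^ 2 := by positivity
    have e3 : 0 ≤ γ * M := by positivity
    have e4 : 0 ≤ γ * M ^ 2 := by positivity
    linarith
  have hB : z ≤ e + γ * (D + 1) * ((K₁ + K₂) * Q) := by
    have e1 : g * h ≤ γ * (K₁ * Q) * D := by gcongr
    have e2 : γ ^ 2 * (K₂ * Q) ≤ γ * (K₂ * Q) := by
      have : γ ^ 2 ≤ γ := by nlinarith
      gcongr
    have e3 : 0 ≤ γ * (K₁ * Q) := by positivity
    have e4 : 0 ≤ γ * (K₂ * Q) * D := by positivity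
    have e5 : 0 ≤ γ * (K₂ * Q) := by positivity
    linarith
  have hC : z ^ 2 ≤ (γ * (D + 1)) ^ 2 * ((8 + M ^ 2) * K₂ * Q) := by
    have e0 : z ^ 2 ≤ 2 * (x * h) ^ 2 + 2 * (y ^ 2 / 2) ^ 2 := by
      rw [← sq_abs]
      have := pow_le_pow_left₀ (abs_nonneg _) hzabs 2
      linarith [sq_nonneg (x * h - y ^ 2 / 2)]
    have e1 : (x * h) ^ 2 ≤ 4 * (γ ^ 2 * (K₂ * Q)) * D ^ 2 := by
      rw [mul_pow]; gcongr
    have e2 : y ^ 2 * y ^ 2 ≤ γ ^ 2 * (K₂ * Q) * M ^ 2 := by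
      refine mul_le_mul hy2 (hy2'.trans ?_) (by positivity) (by positivity)
      exact mul_le_of_le_one_left (sq_nonneg M) hγ₁
    have e3 : 0 ≤ γ ^ 2 * (K₂ * Q) := by positivity
    have e4 : 0 ≤ γ ^ 2 * (K₂ * Q) * M ^ 2 := by positivity
    have e5 : 0 ≤ γ ^ 2 * (K₂ * Q) * M ^ 2 * (D ^ 2 + 2 * D) := by positivity
    have e6 : 0 ≤ γ ^ 2 * (K₂ * Q) * D := by positivity
    linarith
  set s := ρ / (scaleConst M * γ * (D + 1)) with hs
  have hs0 : 0 ≤ s := by positivity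
  have hsγ : s * (γ * (D + 1)) * scaleConst M = ρ := by rw [hs]; field_simp
  have hsγ0 : 0 ≤ s * (γ * (D + 1)) := by positivity
  have hsγ1 : s * (γ * (D + 1)) ≤ 1 :=
    (le_mul_of_one_le_right hsγ0 hb1).trans (hsγ.le.trans hρ₁)
  have hsz : |s * z| ≤ 1 := by
    rw [abs_mul, abs_of_nonneg hs0]
    linarith [mul_le_mul_of_nonneg_left hA hs0]
  have hexp := (abs_le.1 (Real.abs_exp_sub_one_sub_id_le hsz)).2
  have hB' : s * z ≤ s * e + (K₁ + K₂) * Q := by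
    have e1 := mul_le_mul_of_nonneg_left hB hs0
    have e2 : s * (γ * (D + 1)) * ((K₁ + K₂) * Q) ≤ (K₁ + K₂) * Q :=
      mul_le_of_le_one_left (by positivity) hsγ1
    linarith
  have hC' : (s * z) ^ 2 ≤ (8 + M ^ 2) * K₂ * Q := by
    calc (s * z) ^ 2 ≤ s ^ 2 * ((γ * (D + 1)) ^ 2 * ((8 + M ^ 2) * K₂ * Q)) := by
          rw [mul_pow]; gcongr
      _ = (s * (γ * (D + 1))) ^ 2 * ((8 + M ^ 2) * K₂ * Q) := by ring
      _ ≤ _ := mul_le_of_le_one_left (by positivity) (pow_le_one₀ hsγ0 hsγ1)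
  linarith

/-- With the level of order a and the step of order 1/a, second-order terms scale as a^(2-p)/a². The
bias in `step_mul_norm_sub_clip_le` scales as a^(1-p)/a, which is the same power a^(-p). -/
theorem sq_step_mul_rpow_le {p M a r γ : ℝ} (hp₂ : p ≤ 2) (hM : 0 < M) (ha : 0 < a) (hr : 0 < r)
    (hr₂ : r ≤ M * a) : (γ / a) ^ 2 * r ^ (2 - p) ≤ γ ^ 2 * (M ^ (2 - p) * a ^ (-p)) := by
  have e : a ^ (2 - p) / a ^ 2 = a ^ (-p) := by
    rw [← Real.rpow_natCast a 2, ← Real.rpow_sub ha]; congr 1; push_cast; ring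
  calc (γ / a) ^ 2 * r ^ (2 - p) ≤ (γ / a) ^ 2 * (M * a) ^ (2 - p) := by gcongr
    _ = γ ^ 2 * (M ^ (2 - p) * (a ^ (2 - p) / a ^ 2)) := by
        rw [Real.mul_rpow hM.le ha.le]
        field_simp
    _ = _ := by rw [e]

theorem step_mul_norm_sub_clip_le {p ε L lam a r γ : ℝ} (hp : 1 ≤ p) (hε : 0 < ε)
    (hL : 0 < L) (hlam : 0 < lam) (ha : 0 < a) (hr : (1 + ε) * L ≤ r) (hr₁ : lam * a ≤ r)
    (hγ : 0 < γ) {u v : H} (hu : ‖u‖ ≤ L) :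
    γ / a * ‖v - clip v r‖
      ≤ γ * ((ε / (1 + ε) * lam) ^ (1 - p) * (a ^ (-p) * ‖v - u‖ ^ p)) := by
  have e : a ^ (1 - p) / a = a ^ (-p) := by
    rw [← Real.rpow_sub_one ha.ne']; congr 1; ring
  have h' : (ε / (1 + ε) * r) ^ (1 - p) ≤ (ε / (1 + ε) * lam) ^ (1 - p) * a ^ (1 - p) := by
    rw [← Real.mul_rpow (by positivity) ha.le]
    refine Real.rpow_le_rpow_of_nonpos (by positivity) ?_ (by linarith)
    rw [mul_assoc]
    gcongr
  calc γ / a * ‖v - clip v r‖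
      ≤ γ / a * ((ε / (1 + ε) * lam) ^ (1 - p) * a ^ (1 - p) * ‖v - u‖ ^ p) := by
        refine mul_le_mul_of_nonneg_left ((norm_sub_clip_le hp hε hL hr hu).trans ?_)
          (by positivity)
        gcongr
    _ = γ * ((ε / (1 + ε) * lam) ^ (1 - p) * (a ^ (1 - p) / a * ‖v - u‖ ^ p)) := by
        field_simp
    _ = _ := by rw [e]

theorem exp_increment_le {p ε L lam M a r γ D ρ : ℝ} (hp : 1 ≤ p) (hp₂ : p ≤ 2) (hε : 0 < ε)
    (hL : 0 < L) (hlam : 0 < lam) (hM : 0 < M) (ha : 1 ≤ a) (hr : (1 + ε) * L ≤ r)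
    (hr₁ : lam * a ≤ r) (hr₂ : r ≤ M * a) (hγ : 0 < γ) (hγ₁ : γ ≤ 1) (hD : 0 ≤ D)
    (hρ : 0 ≤ ρ) (hρ₁ : ρ ≤ 1) {u v η : H} (hu : ‖u‖ ≤ L) (hη : ‖η‖ ≤ D) :
    Real.exp (ρ / (scaleConst M * γ * (D + 1)) * increment (γ / a) r u v η)
      ≤ 1 + ρ / (scaleConst M * γ * (D + 1)) * (γ / a * inner ℝ (u - v) η)
        + momentConst p ε lam M * (a ^ (-p) * (L ^ p + ‖v - u‖ ^ p)) := by
  have ha0 : 0 < a := by linarith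
  have hLr : L ≤ r := le_trans (by nlinarith) hr
  have hr0 : 0 < r := hL.trans_le hLr
  have h1 := step_mul_norm_sub_clip_le hp hε hL hlam ha0 hr hr₁ hγ hu (v := v)
  have h0 := sq_step_mul_rpow_le (γ := γ) hp₂ hM ha0 hr0 hr₂
  have hsq := sq_norm_clip_le hp hp₂ hL.le hr0 hu (v := v)
  have ht0 : 0 < γ / a := by positivity
  have hzabs := abs_increment_le ht0.le u v η (r := r)
  have hzle := increment_le ht0.le u v η (r := r)
  have h5 : γ / a * r ≤ γ * M := by
    calc γ / a * r ≤ γ / a * (M * a) := by gcongr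
      _ = _ := by field_simp
  set t := γ / a
  have hN0 : 0 ≤ ‖v - u‖ ^ p := by positivity
  set N := ‖v - u‖ ^ p
  have hwr : ‖clip v r‖ ≤ r := norm_clip_le hr0
  set w := clip v r
  have hLp : 0 < L ^ p := by positivity
  have hq : 0 < a ^ (-p) := by positivity
  have hK₁ : 0 ≤ (ε / (1 + ε) * lam) ^ (1 - p) := by positivity
  have hK₂ : 0 ≤ M ^ (2 - p) := by positivity
  have h2 : (t * ‖w‖) ^ 2 ≤ γ ^ 2 * (2 * M ^ (2 - p) * (a ^ (-p) * (L ^ p + N))) := by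
    calc (t * ‖w‖) ^ 2 ≤ t ^ 2 * (2 * r ^ (2 - p) * (L ^ p + N)) := by rw [mul_pow]; gcongr
      _ = t ^ 2 * r ^ (2 - p) * (2 * (L ^ p + N)) := by ring
      _ ≤ γ ^ 2 * (M ^ (2 - p) * a ^ (-p)) * (2 * (L ^ p + N)) := by gcongr
      _ = _ := by ring
  have h3 : (t * ‖u‖) ^ 2 ≤ γ ^ 2 * (2 * M ^ (2 - p) * (a ^ (-p) * (L ^ p + N))) := by
    have h : ‖u‖ ^ 2 ≤ r ^ (2 - p) * L ^ p :=
      (pow_le_pow_left₀ (norm_nonneg _) hu 2).trans (sq_le_rpow_mul_rpow hp₂ hL.le hLr)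
    calc (t * ‖u‖) ^ 2 ≤ t ^ 2 * (r ^ (2 - p) * L ^ p) := by rw [mul_pow]; gcongr
      _ = t ^ 2 * r ^ (2 - p) * L ^ p := by ring
      _ ≤ γ ^ 2 * (M ^ (2 - p) * a ^ (-p)) * (2 * (L ^ p + N)) := by
          refine mul_le_mul h0 ?_ hLp.le (by positivity)
          linarith
      _ = _ := by ring
  have huw : t * ‖u - w‖ ≤ t * ‖u‖ + t * ‖w‖ := by
    rw [← mul_add]
    exact mul_le_mul_of_nonneg_left (norm_sub_le u w) ht0.le
  have h4 : (t * ‖u - w‖) ^ 2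
      ≤ 4 * (γ ^ 2 * (2 * M ^ (2 - p) * (a ^ (-p) * (L ^ p + N)))) := by
    have := pow_le_pow_left₀ (by positivity) huw 2
    linarith [sq_nonneg (t * ‖u‖ - t * ‖w‖)]
  have h6 : t * ‖w‖ ≤ γ * M := (mul_le_mul_of_nonneg_left hwr ht0.le).trans h5
  have h7 : t * ‖u‖ ≤ γ * M := (mul_le_mul_of_nonneg_left (hu.trans hLr) ht0.le).trans h5
  refine exp_le_of_scaled_bounds (x := t * ‖u - w‖) (y := t * ‖w‖) (g := t * ‖v - w‖) (h := ‖η‖)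
    hM hγ hγ₁ hD hρ hρ₁ hK₁ (by positivity) (by positivity) (by positivity) (by positivity)
    (norm_nonneg _) hη (by linarith) h6 (h1.trans ?_) h2 h4 ?_ ?_
  · gcongr
    linarith
  · rw [mul_pow]; exact hzabs
  · rw [mul_pow]; exact hzle

/-- Convexity of the p-th power; it makes the moment bound for a batch independent of m. -/
theorem rpow_norm_average_le {p : ℝ} {m : ℕ} (hp : 1 ≤ p) (hm : 1 ≤ m) (g : Fin m → H) (u : H) :
    ‖(1 / (m : ℝ)) • ∑ j, g j - u‖ ^ p ≤ ∑ j, 1 / (m : ℝ) * ‖g j - u‖ ^ p := by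
  have hm0 : (m : ℝ) ≠ 0 := by positivity
  have e : (1 / (m : ℝ)) • ∑ j, g j - u = ∑ j, (1 / (m : ℝ)) • (g j - u) := by
    rw [← Finset.smul_sum, Finset.sum_sub_distrib, smul_sub]
    simp only [Finset.sum_const, Finset.card_univ, Fintype.card_fin]
    rw [← Nat.cast_smul_eq_nsmul ℝ m u, smul_smul, one_div, inv_mul_cancel₀ hm0, one_smul]
  have h1 : ‖∑ j, (1 / (m : ℝ)) • (g j - u)‖ ≤ ∑ j, 1 / (m : ℝ) * ‖g j - u‖ := by
    refine (norm_sum_le _ _).trans (Finset.sum_le_sum fun j _ => ?_)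
    rw [norm_smul, Real.norm_of_nonneg (by positivity)]
  rw [e]
  refine (Real.rpow_le_rpow (norm_nonneg _) h1 (by linarith)).trans ?_
  exact Real.rpow_arith_mean_le_arith_mean_rpow _ _ _ (fun _ _ => by positivity)
    (by simp [hm0]) (fun _ _ => norm_nonneg _) hp

end Increment

/-! ### Moments of the batch mean and the conditional exponential moment -/

section Oracle

variable {H : Type*} [NormedAddCommGroup H] [InnerProductSpace ℝ H]
  [MeasurableSpace H] {Ω Ξ : Type*} [MeasurableSpace Ω] [MeasurableSpace Ξ] {P : Measure Ω}
  {f : H → ℝ} {X : Set H} {uhat : H → Ξ → H} {ξ : Ω → Ξ} {p σ : ℝ} {m : ℕ}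
  {ξs : ℕ → Fin m → Ω → Ξ}

/-- The average of the stochastic subgradients at `x` over a batch. -/
noncomputable def batchMean (uhat : H → Ξ → H) {m : ℕ} (x : H) (b : Fin m → Ξ) : H :=
  (1 / (m : ℝ)) • ∑ j, uhat x (b j)

theorem IsStochasticSubgradient.measurable_oracle_at
    (h : IsStochasticSubgradient P f X uhat ξ p σ) {x : H} (hx : x ∈ X) :
    Measurable (uhat x) :=
  h.measurable_oracle.comp (measurable_const (a := (⟨x, hx⟩ : X)) |>.prodMk measurable_id)

variable [BorelSpace H]

theorem IsStochasticSubgradient.integrable_sample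
    (h : IsStochasticSubgradient P f X uhat ξ p σ) (hs : IsSampling P ξ m ξs) {x : H} (hx : x ∈ X)
    (n : ℕ) (j : Fin m) : Integrable (fun ω => uhat x (ξs n j ω)) P :=
  ((hs.identDistrib n j).comp (h.measurable_oracle_at hx)).integrable_iff.2 (h.integrable x hx)

theorem IsStochasticSubgradient.integrable_batchMean
    (h : IsStochasticSubgradient P f X uhat ξ p σ) (hs : IsSampling P ξ m ξs) {x : H} (hx : x ∈ X)
    (n : ℕ) : Integrable (fun ω => batchMean uhat x fun j => ξs n j ω) P :=
  (integrable_finsetSum _ fun j _ => h.integrable_sample hs hx n j).smul (1 / (m : ℝ))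

theorem IsStochasticSubgradient.integral_batchMean [CompleteSpace H]
    (h : IsStochasticSubgradient P f X uhat ξ p σ) (hs : IsSampling P ξ m ξs) (hm : 1 ≤ m) {x : H}
    (hx : x ∈ X) (n : ℕ) :
    ∫ ω, batchMean uhat x (fun j => ξs n j ω) ∂P = ∫ ω, uhat x (ξ ω) ∂P := by
  have hm0 : (m : ℝ) ≠ 0 := by positivity
  have h1 : ∀ j, ∫ ω, uhat x (ξs n j ω) ∂P = ∫ ω, uhat x (ξ ω) ∂P := fun j =>
    ((hs.identDistrib n j).comp (h.measurable_oracle_at hx)).integral_eq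
  unfold batchMean
  rw [integral_smul, integral_finsetSum _ fun j _ => h.integrable_sample hs hx n j]
  simp only [h1, Finset.sum_const, Finset.card_univ, Fintype.card_fin]
  rw [← Nat.cast_smul_eq_nsmul ℝ, smul_smul, one_div, inv_mul_cancel₀ hm0, one_smul]

theorem IsStochasticSubgradient.batchMean_moment
    (h : IsStochasticSubgradient P f X uhat ξ p σ) (hs : IsSampling P ξ m ξs) (hp : 1 ≤ p)
    (hm : 1 ≤ m) {x : H} (hx : x ∈ X) (n : ℕ) :
    Integrable (fun ω => ‖batchMean uhat x (fun j => ξs n j ω) - ∫ ω', uhat x (ξ ω') ∂P‖ ^ p) P ∧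
      ∫ ω, ‖batchMean uhat x (fun j => ξs n j ω) - ∫ ω', uhat x (ξ ω') ∂P‖ ^ p ∂P ≤ σ ^ p := by
  have hm0 : (m : ℝ) ≠ 0 := by positivity
  set u := ∫ ω', uhat x (ξ ω') ∂P with hu
  have hid : ∀ j, IdentDistrib (fun ω => ‖uhat x (ξs n j ω) - u‖ ^ p)
      (fun ω => ‖uhat x (ξ ω) - u‖ ^ p) P P := fun j =>
    (hs.identDistrib n j).comp (u := fun s => ‖uhat x s - u‖ ^ p)
      (((h.measurable_oracle_at hx).sub_const u).norm.pow_const p)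
  have hint : ∀ j, Integrable (fun ω => 1 / (m : ℝ) * ‖uhat x (ξs n j ω) - u‖ ^ p) P := fun j =>
    ((hid j).integrable_iff.2 (h.moment_integrable x hx)).const_mul _
  have hsum : Integrable (fun ω => ∑ j, 1 / (m : ℝ) * ‖uhat x (ξs n j ω) - u‖ ^ p) P :=
    integrable_finsetSum _ fun j _ => hint j
  have hle : ∀ ω, ‖batchMean uhat x (fun j => ξs n j ω) - u‖ ^ p
      ≤ ∑ j, 1 / (m : ℝ) * ‖uhat x (ξs n j ω) - u‖ ^ p := fun ω =>
    rpow_norm_average_le hp hm _ u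
  have hi : Integrable (fun ω => ‖batchMean uhat x (fun j => ξs n j ω) - u‖ ^ p) P := by
    refine hsum.mono' ?_ (ae_of_all _ fun ω => ?_)
    · refine AEMeasurable.aestronglyMeasurable ?_
      exact ((((h.integrable_batchMean hs hx n).aestronglyMeasurable.aemeasurable).sub_const
        u).norm).pow_const p
    · rw [Real.norm_of_nonneg (by positivity)]
      exact hle ω
  refine ⟨hi, (integral_mono hi hsum hle).trans ?_⟩
  rw [integral_finsetSum _ fun j _ => hint j]
  simp only [integral_const_mul, fun j => (hid j).integral_eq, Finset.sum_const, Finset.card_univ,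
    Fintype.card_fin, nsmul_eq_mul]
  rw [← mul_assoc, mul_one_div_cancel hm0, one_mul]
  exact h.moment_le x hx

theorem IsStochasticSubgradient.lintegral_exp_increment_le [CompleteSpace H]
    [IsProbabilityMeasure P] (h : IsStochasticSubgradient P f X uhat ξ p σ)
    (hs : IsSampling P ξ m ξs) (hm : 1 ≤ m) {ε lam M a r γ D ρ : ℝ} {L : ℝ≥0}
    (hf : LipschitzWith L f) (hp : 1 ≤ p) (hp₂ : p ≤ 2) (hε : 0 < ε)
    (hL : 0 < L) (hlam : 0 < lam) (hM : 0 < M) (ha : 1 ≤ a) (hr : (1 + ε) * L ≤ r)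
    (hr₁ : lam * a ≤ r) (hr₂ : r ≤ M * a) (hγ : 0 < γ) (hγ₁ : γ ≤ 1) (hD : 0 ≤ D)
    (hρ : 0 ≤ ρ) (hρ₁ : ρ ≤ 1) {x η : H} (hx : x ∈ X) (hη : ‖η‖ ≤ D) (n : ℕ) :
    ∫⁻ ω, ENNReal.ofReal (Real.exp (ρ / (scaleConst M * γ * (D + 1)) *
        increment (γ / a) r (∫ ω', uhat x (ξ ω') ∂P) (batchMean uhat x fun j => ξs n j ω) η)) ∂P
      ≤ ENNReal.ofReal (Real.exp (momentConst p ε lam M * ((L : ℝ) ^ p + σ ^ p) * a ^ (-p))) := by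
  set u := ∫ ω', uhat x (ξ ω') ∂P with hu
  set v : Ω → H := fun ω => batchMean uhat x fun j => ξs n j ω with hv
  obtain ⟨hNi, hN⟩ := h.batchMean_moment hs hp hm hx n
  have hvi : Integrable v P := h.integrable_batchMean hs hx n
  have hvm : ∫ ω, v ω ∂P = u := h.integral_batchMean hs hm hx n
  set s := ρ / (scaleConst M * γ * (D + 1)) with hsdef
  set C := momentConst p ε lam M with hC
  have hC0 : 0 ≤ C := by rw [hC, momentConst]; positivity
  have hpt : ∀ ω, Real.exp (s * increment (γ / a) r u (v ω) η)
      ≤ 1 + s * (γ / a * inner ℝ (u - v ω) η) + C * (a ^ (-p) * (L ^ p + ‖v ω - u‖ ^ p)) := fun ω =>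
    exp_increment_le hp hp₂ hε (NNReal.coe_pos.2 hL) hlam hM ha hr hr₁ hr₂ hγ hγ₁ hD hρ hρ₁
      (norm_le_of_mem_subdifferential hf (h.mean_mem x hx)) hη
  have hi1 : Integrable (fun ω => inner ℝ (u - v ω) η) P :=
    ((integrable_const u).sub hvi).inner_const η
  -- Unbiasedness removes the only term that is of first order in the noise; what remains is of
  -- order a^(-p).
  have hi0 : ∫ ω, inner ℝ (u - v ω) η ∂P = 0 := by
    have e : ∀ ω, inner ℝ (u - v ω) η = inner ℝ η (u - v ω) := fun ω => real_inner_comm _ _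
    simp only [e]
    rw [integral_inner (f := fun ω => u - v ω) ((integrable_const u).sub hvi),
      integral_sub (integrable_const u) hvi, hvm]
    simp
  have hia : Integrable (fun ω => 1 + s * (γ / a * inner ℝ (u - v ω) η)) P :=
    (integrable_const 1).add ((hi1.const_mul _).const_mul _)
  have hib : Integrable (fun ω => C * (a ^ (-p) * ((L : ℝ) ^ p + ‖v ω - u‖ ^ p))) P :=
    ((integrable_const _).add hNi).const_mul _ |>.const_mul _
  calc ∫⁻ ω, ENNReal.ofReal (Real.exp (s * increment (γ / a) r u (v ω) η)) ∂P
      ≤ ∫⁻ ω, ENNReal.ofReal (1 + s * (γ / a * inner ℝ (u - v ω) η)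
          + C * (a ^ (-p) * (L ^ p + ‖v ω - u‖ ^ p))) ∂P :=
        lintegral_mono fun ω => ENNReal.ofReal_le_ofReal (hpt ω)
    _ = ENNReal.ofReal (∫ ω, (1 + s * (γ / a * inner ℝ (u - v ω) η)
          + C * (a ^ (-p) * (L ^ p + ‖v ω - u‖ ^ p))) ∂P) :=
        (ofReal_integral_eq_lintegral_ofReal (hia.add hib)
          (ae_of_all _ fun ω => (Real.exp_nonneg _).trans (hpt ω))).symm
    _ ≤ _ := by
        refine ENNReal.ofReal_le_ofReal ?_
        rw [integral_add hia hib, integral_add (integrable_const 1) ((hi1.const_mul _).const_mul _),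
          integral_const_mul, integral_const_mul, hi0, integral_const_mul, integral_const_mul, integral_add (integrable_const _) hNi]
        simp only [integral_const, probReal_univ, one_smul, mul_zero, add_zero]
        have e1 : C * (a ^ (-p) * (L ^ p + ∫ ω, ‖v ω - u‖ ^ p ∂P))
            ≤ C * (a ^ (-p) * (L ^ p + σ ^ p)) := by gcongr
        have e2 := Real.add_one_le_exp (C * ((L : ℝ) ^ p + σ ^ p) * a ^ (-p))
        linarith

variable [TopologicalSpace.SeparableSpace H]

theorem IsStochasticSubgradient.measurable_batchMean
    (h : IsStochasticSubgradient P f X uhat ξ p σ) :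
    Measurable fun z : X × (Fin m → Ξ) => batchMean uhat (z.1 : H) z.2 := by
  have : SecondCountableTopology H := UniformSpace.secondCountable_of_separable H
  unfold batchMean
  refine Measurable.const_smul (Finset.measurable_sum _ fun j _ => ?_) _
  exact h.measurable_oracle.comp (measurable_fst.prodMk ((measurable_pi_apply j).comp
    measurable_snd))

theorem IsStochasticSubgradient.measurable_mean [CompleteSpace H] [IsProbabilityMeasure P]
    (h : IsStochasticSubgradient P f X uhat ξ p σ) :
    Measurable fun x : X => ∫ ω, uhat x (ξ ω) ∂P := by
  have : SecondCountableTopology H := UniformSpace.secondCountable_of_separable H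
  have h1 : Measurable fun z : X × Ω => uhat z.1 (ξ z.2) :=
    h.measurable_oracle.comp (measurable_fst.prodMk (h.measurable_variable.comp measurable_snd))
  exact h1.stronglyMeasurable.integral_prod_right'.measurable

end Oracle

/-! ### Trajectories, stopped concentration and the general rate -/

section Iterates

variable {H : Type*} [NormedAddCommGroup H] [InnerProductSpace ℝ H] [CompleteSpace H]
  {Ω Ξ : Type*} {X : Set H} {uhat : H → Ξ → H} {step Λ : ℕ → ℝ} {m : ℕ}
  {ξs : ℕ → Fin m → Ω → Ξ} {x₁ : H}

theorem iterate_mem (hc : IsClosed X) (hconv : Convex ℝ X) (hx₁ : x₁ ∈ X) (n : ℕ) (ω : Ω) :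
    iterate X uhat step Λ m ξs x₁ n ω ∈ X := by
  cases n with
  | zero => exact hx₁
  | succ n => exact (proj_spec ⟨x₁, hx₁⟩ hc hconv _).1

variable [MeasurableSpace H] [MeasurableSpace Ω] [MeasurableSpace Ξ] {P : Measure Ω} {f : H → ℝ}
  {ξ : Ω → Ξ} {p σ : ℝ}

/-- The deterministic half of the argument, for one fixed ω: weight 1 confines the iterates to the
ball, after which the stopped sum with weights a (n + 1) / a (k + 1) is the full sum and bounds the
gaps. -/
theorem IsStochasticSubgradient.sub_le_of_sum_increment_le
    (h : IsStochasticSubgradient P f X uhat ξ p σ) {γ D B R : ℝ} {a : ℕ → ℝ} {xs : H} {k : ℕ}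
    {ω : Ω} (hc : IsClosed X) (hconv : Convex ℝ X) (hx₁ : x₁ ∈ X) (hfc : ConvexOn ℝ Set.univ f)
    (hxs : xs ∈ X) (hmin : IsMinOn f X xs) (hR : ‖x₁ - xs‖ ≤ R) (ha0 : 0 < a 1)
    (hmono : Monotone fun n => a (n + 1)) (hstep : ∀ n, step (n + 1) = γ / a (n + 1)) (hγ : 0 < γ)
    (hD : 0 ≤ D) (hB : R ^ 2 + 2 * B ≤ D ^ 2)
    (hsum : ∀ ρ ∈ ({fun _ => 1, fun n => a (n + 1) / a (k + 1)} : Set (ℕ → ℝ)),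
      ∑ n ∈ Finset.range (k + 1),
        (if ∀ j ≤ n, ‖iterate X uhat step Λ m ξs x₁ j ω - xs‖ ≤ D then
          ρ n * increment (step (n + 1)) (Λ (n + 1))
            (∫ ω', uhat (iterate X uhat step Λ m ξs x₁ n ω) (ξ ω') ∂P)
            (batchMean uhat (iterate X uhat step Λ m ξs x₁ n ω) fun j => ξs n j ω)
            (iterate X uhat step Λ m ξs x₁ n ω - xs)
        else 0) ≤ B) :
    f (average X uhat step Λ m ξs x₁ (k + 1) ω) - f xs
      ≤ a (k + 1) / (k + 1 : ℕ) * (D ^ 2 / γ) := by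
  set x : ℕ → H := fun n => iterate X uhat step Λ m ξs x₁ n ω with hx
  have hxX : ∀ n, x n ∈ X := fun n => iterate_mem hc hconv hx₁ n ω
  set z : ℕ → ℝ := fun n => increment (step (n + 1)) (Λ (n + 1)) (∫ ω', uhat (x n) (ξ ω') ∂P)
    (batchMean uhat (x n) fun j => ξs n j ω) (x n - xs) with hz
  have hapos : ∀ n, 0 < a (n + 1) := fun n => ha0.trans_le (hmono (Nat.zero_le n))
  have hst : ∀ n, 0 < step (n + 1) := fun n => by
    rw [hstep]; exact div_pos hγ (hapos n)
  have hE : ∀ n, ‖x (n + 1) - xs‖ ^ 2 + 2 * (γ / a (n + 1)) * (f (x n) - f xs)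
      ≤ ‖x n - xs‖ ^ 2 + 2 * z n := by
    intro n
    rw [← hstep]
    exact sq_norm_proj_step_le hc hconv hxs (h.mean_mem _ (hxX n)) _ (hst n).le
  have hgap : ∀ n, 0 ≤ f (x n) - f xs := fun n => sub_nonneg.2 (hmin (hxX n))
  have hs1 := hsum _ (Set.mem_insert _ _)
  have hs2 := hsum _ (Set.mem_insert_of_mem _ (Set.mem_singleton _))
  simp only [one_mul] at hs1
  have hball : ∀ n ≤ k + 1, ‖x n - xs‖ ≤ D := by
    refine le_of_stopped_sum_le (d := fun n => ‖x n - xs‖) (z := z) (fun n => norm_nonneg _) hD hR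
      (fun n => ?_) ?_ hB
    · have := mul_nonneg (mul_nonneg zero_le_two (div_pos hγ (hapos n)).le) (hgap n)
      linarith [hE n]
    · convert hs1
  have hs2' : ∑ n ∈ Finset.range (k + 1), a (n + 1) / a (k + 1) * z n ≤ B := by
    refine le_trans (le_of_eq (Finset.sum_congr rfl fun n hn => ?_)) hs2
    rw [if_pos]
    intro j hj
    exact hball j (by have := Finset.mem_range.1 hn; omega)
  have hfin := sum_gap_le (a := fun n => a (n + 1)) (d := fun n => ‖x n - xs‖)
    (g := fun n => f (x n) - f xs) (z := z) hmono ha0 hγ (fun n => norm_nonneg _)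
    (fun n hn => hball n (by omega)) hE hs2'
  have hk : (0 : ℝ) < (k + 1 : ℕ) := by positivity
  have hJ : f (average X uhat step Λ m ξs x₁ (k + 1) ω)
      ≤ ∑ n ∈ Finset.range (k + 1), 1 / ((k + 1 : ℕ) : ℝ) * f (x n) := by
    rw [average, Finset.smul_sum]
    exact hfc.map_sum_le (fun _ _ => by positivity)
      (by rw [Finset.sum_const, Finset.card_range, nsmul_eq_mul, mul_one_div_cancel hk.ne'])
      fun _ _ => Set.mem_univ _
  have hS : ∑ n ∈ Finset.range (k + 1), 1 / ((k + 1 : ℕ) : ℝ) * f (x n) - f xs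
      = (∑ n ∈ Finset.range (k + 1), (f (x n) - f xs)) / (k + 1 : ℕ) := by
    rw [← Finset.mul_sum, Finset.sum_sub_distrib, Finset.sum_const, Finset.card_range,
      nsmul_eq_mul]
    field_simp
  have hS2 : ∑ n ∈ Finset.range (k + 1), (f (x n) - f xs) ≤ a (k + 1) * (D ^ 2 / γ) := by
    rw [mul_div_assoc', le_div_iff₀ hγ]
    -- The condition R² + 2B ≤ D² also absorbs the error here, and the resulting factor 2 cancels
    -- that in 2γ.
    have : a (k + 1) * (D ^ 2 + 2 * B) ≤ a (k + 1) * (2 * D ^ 2) :=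
      mul_le_mul_of_nonneg_left (by linarith [sq_nonneg R]) (hapos k).le
    linarith
  calc f (average X uhat step Λ m ξs x₁ (k + 1) ω) - f xs
      ≤ (∑ n ∈ Finset.range (k + 1), (f (x n) - f xs)) / (k + 1 : ℕ) := by linarith
    _ ≤ a (k + 1) * (D ^ 2 / γ) / (k + 1 : ℕ) := by gcongr
    _ = _ := by ring

variable [TopologicalSpace.SeparableSpace H] [BorelSpace H]

theorem IsStochasticSubgradient.measurable_iterate
    (h : IsStochasticSubgradient P f X uhat ξ p σ) (hc : IsClosed X) (hconv : Convex ℝ X)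
    (hx₁ : x₁ ∈ X) (n : ℕ) :
    Measurable[past ξs n] fun ω =>
      (⟨iterate X uhat step Λ m ξs x₁ n ω, iterate_mem hc hconv hx₁ n ω⟩ : X) := by
  have : SecondCountableTopology H := UniformSpace.secondCountable_of_separable H
  induction n with
  | zero => exact measurable_const (a := (⟨x₁, hx₁⟩ : X))
  | succ n ih =>
    have hF : Measurable fun z : X × (Fin m → Ξ) =>
        proj X ((z.1 : H) - step (n + 1) • clip (batchMean uhat (z.1 : H) z.2) (Λ (n + 1))) := by
      refine (continuous_proj ⟨x₁, hx₁⟩ hc hconv).measurable.comp ?_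
      refine (measurable_subtype_coe.comp measurable_fst).sub (Measurable.const_smul ?_ _)
      exact (continuous_clip _).measurable.comp h.measurable_batchMean
    exact (hF.comp ((ih.mono (past_mono n.le_succ) le_rfl).prodMk
      (measurable_batch_past n))).subtype_mk

/-- High-probability control of the accumulated clipping errors, stopped when the iterates leave
the ball of radius `D` around `xs`. -/
theorem IsStochasticSubgradient.measure_stopped_increment_ge_le [IsProbabilityMeasure P]
    (h : IsStochasticSubgradient P f X uhat ξ p σ) (hs : IsSampling P ξ m ξs) (hm : 1 ≤ m)
    {ε lam M γ D : ℝ} {L : ℝ≥0} {a ρ : ℕ → ℝ} (hc : IsClosed X) (hconv : Convex ℝ X)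
    (hx₁ : x₁ ∈ X) (hf : LipschitzWith L f) (hp : 1 ≤ p) (hp₂ : p ≤ 2) (hσ : 0 ≤ σ) (hε : 0 < ε)
    (hL : 0 < L) (hlam : 0 < lam) (hM : 0 < M) (ha : ∀ n, 1 ≤ a (n + 1))
    (hr : ∀ n, (1 + ε) * L ≤ Λ (n + 1)) (hr₁ : ∀ n, lam * a (n + 1) ≤ Λ (n + 1))
    (hr₂ : ∀ n, Λ (n + 1) ≤ M * a (n + 1)) (hstep : ∀ n, step (n + 1) = γ / a (n + 1))
    (hγ : 0 < γ) (hγ₁ : γ ≤ 1) (hD : 0 ≤ D)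
    (hρ : ∀ n, 0 ≤ ρ n) {k : ℕ} (hρ₁ : ∀ n < k, ρ n ≤ 1) {ℓ : ℝ}
    (hℓ : ∑ n ∈ Finset.range k, a (n + 1) ^ (-p) ≤ ℓ) (xs : H) (t : ℝ) :
    P {ω | scaleConst M * γ * (D + 1) * (momentConst p ε lam M * ((L : ℝ) ^ p + σ ^ p) * ℓ + t)
        ≤ ∑ n ∈ Finset.range k,
          if ∀ j ≤ n, ‖iterate X uhat step Λ m ξs x₁ j ω - xs‖ ≤ D then
            ρ n * increment (step (n + 1)) (Λ (n + 1))
              (∫ ω', uhat (iterate X uhat step Λ m ξs x₁ n ω) (ξ ω') ∂P)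
              (batchMean uhat (iterate X uhat step Λ m ξs x₁ n ω) fun j => ξs n j ω)
              (iterate X uhat step Λ m ξs x₁ n ω - xs)
          else 0}
      ≤ ENNReal.ofReal (Real.exp (-t)) := by
  classical
  have : SecondCountableTopology H := UniformSpace.secondCountable_of_separable H
  set K := scaleConst M * γ * (D + 1) with hK
  have hK0 : 0 < K := by rw [hK, scaleConst]; positivity
  set C := momentConst p ε lam M * ((L : ℝ) ^ p + σ ^ p) with hC
  have hC0 : 0 ≤ C := by rw [hC, momentConst]; positivity
  -- The weights are bounded by 1 only up to the horizon, whereas the concentration lemma asks for a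
  -- bound at every index; truncation changes nothing below k.
  set ρ' : ℕ → ℝ := fun n => min (ρ n) 1 with hρ'
  have hρ'ρ : ∀ n < k, ρ' n = ρ n := fun n hn => min_eq_left (hρ₁ n hn)
  -- The state space is the subtype X because the oracle is jointly measurable only there.
  set x : ℕ → Ω → X := fun n ω =>
    ⟨iterate X uhat step Λ m ξs x₁ n ω, iterate_mem hc hconv hx₁ n ω⟩ with hx
  set ζ : ℕ → X × (Fin m → Ξ) → ℝ := fun n z =>
    ρ' n / K * increment (γ / a (n + 1)) (Λ (n + 1)) (∫ ω', uhat (z.1 : H) (ξ ω') ∂P)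
      (batchMean uhat (z.1 : H) z.2) (z.1 - xs) with hζ
  have hζm : ∀ n, Measurable (ζ n) := by
    intro n
    have h1 : Measurable fun z : X × (Fin m → Ξ) => ∫ ω', uhat (z.1 : H) (ξ ω') ∂P :=
      h.measurable_mean.comp measurable_fst
    have h2 : Measurable fun z : X × (Fin m → Ξ) =>
        clip (batchMean uhat (z.1 : H) z.2) (Λ (n + 1)) :=
      (continuous_clip _).measurable.comp h.measurable_batchMean
    have h3 : Measurable fun z : X × (Fin m → Ξ) => (z.1 : H) - xs :=
      (measurable_subtype_coe.comp measurable_fst).sub_const xs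
    exact ((((h1.sub h2).inner h3).const_mul _).add
      (((h2.norm.pow_const 2).const_mul _).div_const 2)).const_mul _
  have hG : MeasurableSet {y : X | ‖(y : H) - xs‖ ≤ D} :=
    measurableSet_le (measurable_subtype_coe.sub_const xs).norm measurable_const
  have key := measure_stopped_sum_ge_le (P := P) (past_le hs.measurable) past_mono (x := x)
    (fun n => h.measurable_iterate hc hconv hx₁ n) measurable_batch_past hs.indep_past hζm
    (G := fun y : X => ‖(y : H) - xs‖ ≤ D) hG (c := fun n => C * a (n + 1) ^ (-p))
    (fun n => mul_nonneg hC0 (Real.rpow_nonneg (by linarith [ha n]) _))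
    (fun n y hy => h.lintegral_exp_increment_le hs hm hf hp hp₂ hε hL hlam hM (ha n) (hr n)
      (hr₁ n) (hr₂ n) hγ hγ₁ hD (le_min (hρ n) zero_le_one) (min_le_right _ _) y.2 hy n) k t
  refine (measure_mono fun ω hω => ?_).trans key
  rw [Set.mem_ofPred_eq] at hω ⊢
  rw [← Finset.mul_sum]
  have e : K * ∑ n ∈ Finset.range k,
        (if ∀ j ≤ n, ‖(x j ω : H) - xs‖ ≤ D then ζ n (x n ω, fun j => ξs n j ω) else 0)
      = ∑ n ∈ Finset.range k,
        if ∀ j ≤ n, ‖iterate X uhat step Λ m ξs x₁ j ω - xs‖ ≤ D then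
          ρ n * increment (step (n + 1)) (Λ (n + 1))
            (∫ ω', uhat (iterate X uhat step Λ m ξs x₁ n ω) (ξ ω') ∂P)
            (batchMean uhat (iterate X uhat step Λ m ξs x₁ n ω) fun j => ξs n j ω)
            (iterate X uhat step Λ m ξs x₁ n ω - xs)
        else 0 := by
    rw [Finset.mul_sum]
    refine Finset.sum_congr rfl fun n hn => ?_
    rw [mul_ite, mul_zero]
    refine if_congr Iff.rfl ?_ rfl
    rw [hstep n, hζ]
    simp only [hρ'ρ n (Finset.mem_range.1 hn)]
    rw [← mul_assoc, mul_div_cancel₀ _ hK0.ne']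
  rw [← e] at hω
  have h1 := le_of_mul_le_mul_left hω hK0
  have h2 := mul_le_mul_of_nonneg_left hℓ hC0
  linarith

/-- The constant that controls the size of the iterates. -/
noncomputable def radiusConst (p σ ε lam R L : ℝ) : ℝ :=
  R + 4 * (scaleConst ((1 + ε) * L + lam)
    * (momentConst p ε lam ((1 + ε) * L + lam) * (L ^ p + σ ^ p) + 1)) + 1

/-- The schedule enters only through the monotone sequence a and the bound ℓ on the sum of its
powers, so the anytime and finite-horizon claims are both instances. -/
theorem IsStochasticSubgradient.rate [IsProbabilityMeasure P]
    (h : IsStochasticSubgradient P f X uhat ξ p σ) (hs : IsSampling P ξ m ξs) (hm : 1 ≤ m)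
    {ε lam γ R δ ℓ : ℝ} {L : ℝ≥0} {a : ℕ → ℝ} {xs : H} (hc : IsClosed X) (hconv : Convex ℝ X)
    (hx₁ : x₁ ∈ X) (hfc : ConvexOn ℝ Set.univ f) (hf : LipschitzWith L f) (hxs : xs ∈ X)
    (hmin : IsMinOn f X xs) (hR : ‖x₁ - xs‖ ≤ R) (hp : 1 ≤ p) (hp₂ : p ≤ 2) (hσ : 0 ≤ σ)
    (hε : 0 < ε) (hL : 0 < L) (hlam : 0 < lam) (hδ : 0 < δ) (hδ₁ : δ ≤ 2 / Real.exp 1)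
    (hγ : γ = 1 / Real.log (2 / δ)) (ha : ∀ n, 1 ≤ a (n + 1)) (hmono : Monotone fun n => a (n + 1))
    (k : ℕ) (hℓ : ∑ n ∈ Finset.range (k + 1), a (n + 1) ^ (-p) ≤ ℓ) :
    1 - δ ≤ P.real {ω | f (average X uhat (fun i => γ / a i)
        (fun i => max ((1 + ε) * L) (lam * a i)) m ξs x₁ (k + 1) ω) - f xs
      ≤ 2 * radiusConst p σ ε lam R L ^ 2
        * (a (k + 1) / (k + 1 : ℕ) * (ℓ ^ 2 + Real.log (2 / δ)))} := by
  set T := Real.log (2 / δ) with hT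
  -- This is the role of δ ≤ 2/e: it gives T ≥ 1, hence γ ≤ 1.
  have hT1 : 1 ≤ T := by
    rw [hT, Real.le_log_iff_exp_le (by positivity), le_div_iff₀ hδ]
    rwa [le_div_iff₀ (Real.exp_pos 1), mul_comm] at hδ₁
  have hT0 : 0 < T := by linarith
  have hγ0 : 0 < γ := by rw [hγ]; positivity
  have hγ1 : γ ≤ 1 := by rw [hγ, div_le_one hT0]; exact hT1
  have hγT : γ * T = 1 := by rw [hγ]; field_simp
  have hL' : (0 : ℝ) < L := hL
  have hR0 : 0 ≤ R := (norm_nonneg _).trans hR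
  have hℓ0 : 0 ≤ ℓ := (Finset.sum_nonneg fun n _ =>
    Real.rpow_nonneg (by linarith [ha n]) _).trans hℓ
  set M := (1 + ε) * L + lam with hM
  have hM0 : 0 < M := by positivity
  set C := momentConst p ε lam M * ((L : ℝ) ^ p + σ ^ p) with hC
  have hC0 : 0 ≤ C := by rw [hC, momentConst]; positivity
  set b := scaleConst M with hb
  have hb0 : 0 < b := by rw [hb, scaleConst]; positivity
  set C₁ := radiusConst p σ ε lam R L with hC₁
  have hC₁e : C₁ = R + 4 * (b * (C + 1)) + 1 := rfl
  set G := 1 + γ * ℓ with hG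
  have hG1 : 1 ≤ G := by rw [hG]; linarith [mul_nonneg hγ0.le hℓ0]
  have hE0 : 0 < b * (C + 1) := by positivity
  have hC₁1 : 1 ≤ C₁ := by linarith
  set D := C₁ * G with hD
  have hD0 : 0 ≤ D := by positivity
  set B := b * γ * (D + 1) * (C * ℓ + T) with hB
  -- Since γT = 1, the confidence term contributes only a constant to B.
  have hBle : B ≤ b * (C + 1) * (D + 1) * G := by
    have e : B = b * (D + 1) * (C * (γ * ℓ) + 1) := by
      calc B = b * (D + 1) * (C * (γ * ℓ) + γ * T) := by rw [hB]; ring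
        _ = _ := by rw [hγT]
    have e2 : C * (γ * ℓ) + 1 ≤ (C + 1) * G := by
      rw [hG]
      linarith [mul_nonneg hγ0.le hℓ0]
    rw [e]
    calc b * (D + 1) * (C * (γ * ℓ) + 1) ≤ b * (D + 1) * ((C + 1) * G) := by gcongr
      _ = _ := by ring
  have hRB : R ^ 2 + 2 * B ≤ D ^ 2 := by
    set E := b * (C + 1)
    have e1 : D + 1 ≤ 2 * C₁ * G := by
      have : 1 ≤ C₁ * G := one_le_mul_of_one_le_of_one_le hC₁1 hG1
      linarith
    have e2 : 2 * B ≤ 4 * E * C₁ * G ^ 2 := by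
      have : E * (D + 1) * G ≤ E * (2 * C₁ * G) * G := by gcongr
      linarith
    have e3 : R ^ 2 ≤ R * C₁ * G ^ 2 := by
      have h1 : R * R ≤ R * C₁ := by gcongr; linarith
      have h2 : R * C₁ ≤ R * C₁ * G ^ 2 :=
        le_mul_of_one_le_right (by positivity) (one_le_pow₀ hG1)
      linarith
    -- Only one of the two factors C₁ is expanded: its summand R pays for R² and its summand 4E for
    -- 2B.
    have e4 : D ^ 2 = (R + 4 * E + 1) * C₁ * G ^ 2 := by
      rw [hD, mul_pow, sq C₁]
      nth_rewrite 1 [hC₁e]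
      ring
    have e5 : 0 ≤ C₁ * G ^ 2 := by positivity
    rw [e4]
    linarith
  set step : ℕ → ℝ := fun i => γ / a i with hstep
  set Λ : ℕ → ℝ := fun i => max ((1 + ε) * L) (lam * a i) with hΛ
  have hΛM : ∀ n, Λ (n + 1) ≤ M * a (n + 1) := by
    intro n
    have h1 : 0 ≤ (1 + ε) * L := by positivity
    have h2 := mul_le_mul_of_nonneg_left (ha n) h1
    refine max_le ?_ ?_
    · rw [hM]
      linarith [mul_nonneg hlam.le (zero_le_one.trans (ha n))]
    · rw [hM]
      linarith
  set bad : (ℕ → ℝ) → Set Ω := fun ρ => {ω | B ≤ ∑ n ∈ Finset.range (k + 1),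
    (if ∀ j ≤ n, ‖iterate X uhat step Λ m ξs x₁ j ω - xs‖ ≤ D then
      ρ n * increment (step (n + 1)) (Λ (n + 1))
        (∫ ω', uhat (iterate X uhat step Λ m ξs x₁ n ω) (ξ ω') ∂P)
        (batchMean uhat (iterate X uhat step Λ m ξs x₁ n ω) fun j => ξs n j ω)
        (iterate X uhat step Λ m ξs x₁ n ω - xs)
    else 0)} with hbad
  have hak : 0 < a (k + 1) := by linarith [ha k]
  have hbadP : ∀ ρ ∈ ({fun _ => 1, fun n => a (n + 1) / a (k + 1)} : Set (ℕ → ℝ)),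
      P.real (bad ρ) ≤ δ / 2 := by
    intro ρ hρ
    have hρ0 : ∀ n, 0 ≤ ρ n := by
      rcases hρ with rfl | rfl
      · exact fun _ => zero_le_one
      · exact fun n => div_nonneg (by linarith [ha n]) hak.le
    have hρ1 : ∀ n < k + 1, ρ n ≤ 1 := by
      rcases hρ with rfl | rfl
      · exact fun _ _ => le_rfl
      · exact fun n hn => (div_le_one hak).2 (hmono (by omega))
    have := h.measure_stopped_increment_ge_le (step := step) (Λ := Λ) hs hm hc hconv hx₁ hf hp hp₂
      hσ hε hL hlam hM0 ha (fun n => le_max_left _ _) (fun n => le_max_right _ _) hΛM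
      (fun n => rfl) hγ0 hγ1 hD0 hρ0 hρ1 hℓ xs T
    have e : Real.exp (-T) = δ / 2 := by
      rw [Real.exp_neg, hT, Real.exp_log (by positivity), inv_div]
    rw [e] at this
    exact ENNReal.toReal_le_of_le_ofReal (by positivity) this
  have hsub : (Set.univ : Set Ω) ⊆ {ω | f (average X uhat step Λ m ξs x₁ (k + 1) ω) - f xs
      ≤ 2 * C₁ ^ 2 * (a (k + 1) / (k + 1 : ℕ) * (ℓ ^ 2 + T))}
      ∪ (bad (fun _ => 1) ∪ bad fun n => a (n + 1) / a (k + 1)) := by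
    intro ω _
    by_contra hω
    rw [Set.mem_union, Set.mem_union, not_or, not_or] at hω
    obtain ⟨h1, h2, h3⟩ := hω
    refine h1 ?_
    have hfin := h.sub_le_of_sum_increment_le (step := step) (Λ := Λ) (ξs := ξs) (ω := ω) (k := k)
      (B := B) hc hconv hx₁ hfc hxs hmin hR (by linarith [ha 0]) hmono (fun n => rfl) hγ0 hD0 hRB
      (by
        rintro ρ (rfl | rfl)
        · exact (not_le.1 h2).le
        · exact (not_le.1 h3).le)
    refine hfin.trans ?_
    have e : D ^ 2 / γ ≤ 2 * C₁ ^ 2 * (ℓ ^ 2 + T) := by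
      rw [div_le_iff₀ hγ0, hD, mul_pow]
      -- Dividing D² by γ turns the constant 1 = γT into T, and (γℓ)² ≤ γℓ² into ℓ².
      have e1 : G ^ 2 ≤ 2 + 2 * (γ * ℓ) ^ 2 := by
        rw [hG]
        linarith [sq_nonneg (1 - γ * ℓ)]
      have e2 : (γ * ℓ) ^ 2 ≤ γ * ℓ ^ 2 := by
        calc (γ * ℓ) ^ 2 = γ * (γ * ℓ ^ 2) := by ring
          _ ≤ γ * ℓ ^ 2 :=
            mul_le_mul_of_nonneg_left (mul_le_of_le_one_left (sq_nonneg ℓ) hγ1) hγ0.le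
      calc C₁ ^ 2 * G ^ 2 ≤ C₁ ^ 2 * (2 * (γ * ℓ ^ 2 + γ * T)) := by
            gcongr
            linarith
        _ = _ := by ring
    calc a (k + 1) / (k + 1 : ℕ) * (D ^ 2 / γ)
        ≤ a (k + 1) / (k + 1 : ℕ) * (2 * C₁ ^ 2 * (ℓ ^ 2 + T)) := by gcongr
      _ = _ := by ring
  have h1 := measureReal_mono hsub (measure_ne_top P _)
  have h2 := hbadP _ (Set.mem_insert _ _)
  have h3 := hbadP _ (Set.mem_insert_of_mem _ (Set.mem_singleton _))
  rw [probReal_univ] at h1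
  have h4 := measureReal_union_le (μ := P) {ω | f (average X uhat step Λ m ξs x₁ (k + 1) ω) - f xs
      ≤ 2 * C₁ ^ 2 * (a (k + 1) / (k + 1 : ℕ) * (ℓ ^ 2 + T))}
      (bad (fun _ => 1) ∪ bad fun n => a (n + 1) / a (k + 1))
  have h5 := measureReal_union_le (μ := P) (bad (fun _ => 1)) (bad fun n => a (n + 1) / a (k + 1))
  linarith

end Iterates

end ClippedSsGM

/-! ### The anytime and finite-horizon schedules -/

theorem mainTheorem6 (p σ ε lam R : ℝ) (L : ℝ≥0) (hp₁ : 1 < p) (hp₂ : p ≤ 2) (hσ : 0 ≤ σ)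
    (hε : 0 < ε) (hlam : 0 < lam) (hL : 0 < L) :
    ∃ c : ℝ, 0 ≤ c ∧
      ∀ (H : Type*) [NormedAddCommGroup H] [InnerProductSpace ℝ H] [CompleteSpace H]
        [TopologicalSpace.SeparableSpace H] [MeasurableSpace H] [BorelSpace H]
        (Ω Ξ : Type*) [MeasurableSpace Ω] [MeasurableSpace Ξ]
        (P : Measure Ω) [IsProbabilityMeasure P]
        (f : H → ℝ) (X : Set H) (uhat : H → Ξ → H) (ξ : Ω → Ξ)
        (m : ℕ) (ξs : ℕ → Fin m → Ω → Ξ) (x₁ xstar : H),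
        ConvexOn ℝ Set.univ f → LipschitzWith L f →
        IsClosed X → Convex ℝ X →
        xstar ∈ X → IsMinOn f X xstar →
        ClippedSsGM.IsStochasticSubgradient P f X uhat ξ p σ →
        1 ≤ m → ClippedSsGM.IsSampling P ξ m ξs →
        x₁ ∈ X → ‖x₁ - xstar‖ ≤ R →
        ∀ δ : ℝ, 0 < δ → δ ≤ 2 / Real.exp 1 → ∀ γ : ℝ, γ = 1 / Real.log (2 / δ) →
        ∀ k : ℕ, 1 ≤ k →
          (1 - δ ≤ P.real {ω |
            f (ClippedSsGM.average X uhat (ClippedSsGM.stepAT p γ)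
                (ClippedSsGM.clipAT p L ε lam) m ξs x₁ k ω) - f xstar
              ≤ c * ((1 + Real.log k) ^ (1 / p) / (k : ℝ) ^ ((p - 1) / p)
                * ((1 + Real.log (1 + Real.log k)) ^ 2 + Real.log (2 / δ)))}) ∧
          (1 - δ ≤ P.real {ω |
            f (ClippedSsGM.average X uhat (ClippedSsGM.stepFH p γ k)
                (ClippedSsGM.clipFH p L ε lam k) m ξs x₁ k ω) - f xstar
              ≤ c * (1 / (k : ℝ) ^ ((p - 1) / p) * (1 + Real.log (2 / δ)))}) := by
  refine ⟨2 * ClippedSsGM.radiusConst p σ ε lam R L ^ 2, by positivity, ?_⟩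
  intro H _ _ _ _ _ _ Ω Ξ _ _ P _ f X uhat ξ m ξs x₁ xstar hfc hf hc hconv hxs hmin h hm hs hx₁ hR
    δ hδ hδ₁ γ hγ k hk
  obtain ⟨k, rfl⟩ : ∃ n, k = n + 1 := ⟨k - 1, by omega⟩
  have hp0 : 0 < p := by linarith
  have hk0 : (0 : ℝ) < (k + 1 : ℕ) := by positivity
  have hpow : ∀ y : ℝ, 0 ≤ y → (y ^ (1 / p)) ^ (-p) = y⁻¹ := fun y hy => by
    rw [← Real.rpow_mul hy, ← Real.rpow_neg_one]
    congr 1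
    field_simp
  have hdiv : ((k + 1 : ℕ) : ℝ) ^ (1 / p) / (k + 1 : ℕ)
      = 1 / ((k + 1 : ℕ) : ℝ) ^ ((p - 1) / p) := by
    rw [← Real.rpow_sub_one hk0.ne', one_div (_ ^ ((p - 1) / p)), ← Real.rpow_neg hk0.le]
    congr 1
    field_simp
    ring
  have hlog : ∀ n : ℕ, 0 ≤ Real.log (n + 1 : ℕ) := fun n => Real.log_natCast_nonneg _
  constructor
  · have hmono : Monotone fun n : ℕ =>
        (((n + 1 : ℕ) : ℝ) * (1 + Real.log (n + 1 : ℕ))) ^ (1 / p) := by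
      intro i j hij
      have := hlog i
      have hij' : ((i + 1 : ℕ) : ℝ) ≤ (j + 1 : ℕ) := by exact_mod_cast Nat.succ_le_succ hij
      dsimp only
      gcongr
    have ha : ∀ n : ℕ, 1 ≤ (((n + 1 : ℕ) : ℝ) * (1 + Real.log (n + 1 : ℕ))) ^ (1 / p) := by
      intro n
      refine le_trans ?_ (hmono (Nat.zero_le n))
      simp
    -- Here a^(-p) is 1/(n(1 + log n)), so ℓ is an iterated logarithm.
    have hsum : ∑ n ∈ Finset.range (k + 1),
        ((((n + 1 : ℕ) : ℝ) * (1 + Real.log (n + 1 : ℕ))) ^ (1 / p)) ^ (-p)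
          ≤ 1 + Real.log (1 + Real.log (k + 1 : ℕ)) := by
      refine le_trans (le_of_eq (Finset.sum_congr rfl fun n _ => hpow _ ?_))
        (ClippedSsGM.sum_inv_mul_one_add_log_le k)
      have := hlog n
      positivity
    have key := h.rate hs hm hc hconv hx₁ hfc hf hxs hmin hR hp₁.le hp₂ hσ hε hL hlam hδ hδ₁ hγ
      (a := fun n : ℕ => ((n : ℝ) * (1 + Real.log n)) ^ (1 / p)) ha hmono k hsum
    have e : (((k + 1 : ℕ) : ℝ) * (1 + Real.log (k + 1 : ℕ))) ^ (1 / p) / (k + 1 : ℕ)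
        = (1 + Real.log (k + 1 : ℕ)) ^ (1 / p) / ((k + 1 : ℕ) : ℝ) ^ ((p - 1) / p) := by
      rw [Real.mul_rpow hk0.le (by linarith [hlog k]), mul_comm, mul_div_assoc, hdiv,
        mul_one_div]
    rw [e] at key
    exact key
  -- With the constant schedule, k + 1 terms equal to 1/(k + 1) give ℓ = 1, and ℓ² becomes the
  -- summand 1 of the rate.
  · have hsum : ∑ n ∈ Finset.range (k + 1), (((k + 1 : ℕ) : ℝ) ^ (1 / p)) ^ (-p) ≤ 1 := by
      rw [Finset.sum_const, Finset.card_range, nsmul_eq_mul, hpow _ hk0.le,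
        mul_inv_cancel₀ hk0.ne']
    have key := h.rate hs hm hc hconv hx₁ hfc hf hxs hmin hR hp₁.le hp₂ hσ hε hL hlam hδ hδ₁ hγ
      (a := fun _ : ℕ => ((k + 1 : ℕ) : ℝ) ^ (1 / p))
      (fun _ => Real.one_le_rpow (by exact_mod_cast Nat.succ_le_succ (Nat.zero_le k))
        (by positivity)) monotone_const k hsum
    rw [hdiv, one_pow] at key
    exact key
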